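/- Let $\mathcal S$ be the family of real biquadratic fields $K=\mathbb Q(\sqrt a,\sqrt b)$ with $a,b$ odd squarefree positive integers and $[K:\mathbb Q]=4$, where each field is counted once (equivalently, $\mathcal S$ is a set of subfields of $\mathbb R$). Let $\Delta_K$ be the discriminant of $K$, and for $X>0$ put $\mathcal S(X)=\#\{K\in\mathcal S : |\Delta_K|\le X\}$, which is finite. Then, as $X\to\infty$, $$\mathcal S(X)=\frac{7}{1920}\,\sqrt X\,(\log X)^2\prod_{p}\Bigl(1-\frac1p\Bigr)^3\Bigl(1+\frac3p\Bigr)+O\bigl(\sqrt X\log X\bigr),$$ where the product runs over all primes $p$ (including $p=2$) and converges absolutely. -/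

import Mathlib

open Filter Asymptotics

/-- The real biquadratic fields `ℚ(√a, √b)` with `a, b` odd, squarefree (and positive), realised as
subfields of `ℝ`. Such a field is Galois over `ℚ`, so each isomorphism class has exactly one
representative in `ℝ`. The degree condition says that the field is really biquadratic. -/
def oddRealBiquadraticFields : Set (IntermediateField ℚ ℝ) :=
  {K | Module.finrank ℚ K = 4 ∧
    ∃ a b : ℕ, Odd a ∧ Odd b ∧ Squarefree a ∧ Squarefree b ∧
      K = IntermediateField.adjoin ℚ {Real.sqrt (a : ℝ), Real.sqrt (b : ℝ)}}

/-- The fields of the family whose absolute discriminant is at most `X`. -/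
def oddRealBiquadraticFieldsUpTo (X : ℝ) : Set (IntermediateField ℚ ℝ) :=
  {K | K ∈ oddRealBiquadraticFields ∧
    ∃ _ : NumberField K, ((|NumberField.discr K| : ℤ) : ℝ) ≤ X}

/-- The local factor `(1 - 1/p)^3 (1 + 3/p)`. -/
noncomputable def biquadraticEulerFactor (p : Nat.Primes) : ℝ :=
  (1 - 1 / (p : ℝ)) ^ 3 * (1 + 3 / (p : ℝ))

/-! Put `g = gcd(a, b)`, `a = gv`, `b = gw`. The field is then `ℚ(√(uv), √(uw), √(vw))` with `u =
g`, where `u, v, w` are odd, distinct, and have squarefree product. The triple is determined by the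
field up to order, because `uv, uw, vw` are the only squarefree integers `≠ 1` that are squares in
it (`biquadraticField_injOn`, `exists_triple_of_mem`). An explicit integral basis gives the
discriminant: `(uvw)²` if `u ≡ v ≡ w` mod 4, and `16(uvw)²` otherwise (`BiquadraticFrame.discr_eq`).

Counting fields is thus counting triples. Up to `O(√X)` triples with a repeated entry, six times the
count is the number of ordered triples with `uvw ≤ √X` that agree mod 4, plus the number with `uvw ≤
√X/4` that do not. For odd entries the indicator of agreement is `(1 + χ(u)χ(v) + χ(u)χ(w) +
χ(v)χ(w))/4` with `χ` the character mod 4. So only two sums are needed: `T(y)`, the number of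
ordered triples with `uvw ≤ y`, and its twist `T_χ(y)` by `χ(u)χ(v)`.

Each summand is a Dirichlet convolution `g * (c * c * ζ)` with `c = ζ` or `c = χ`. The correction
`g` is small: at odd primes its local series has no linear term, so `∑ |g(n)| n^(-3/4)` converges.
Elementary summation gives `T(y) = C y (log y)²/2 + O(y log y)` with `C = ∑ g(n)/n`, and bounded
partial sums of `χ` give `T_χ(y) = O(y log y)`.

Hence `6 S(X)` has main term `(C/2)(1/4 + 3/16) √X (log √X)²`. The Euler product equals `5C/2`, its
factor at 2 having an extra `1 + 3/2`, and this produces `7/1920`. -/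

/-! ### Biquadratic fields in coordinates: Galois action, denominators, trace form. -/

/-- `r, s, t` behave as the square roots of `uv`, `uw`, `vw`, and `1, r, s, t` is a `ℚ`-basis of
the field `K`. -/
structure BiquadraticFrame {K : Type*} [Field K] [CharZero K] (u v w : ℕ) (r s t : K) : Prop where
  mul_rs : r * s = u * t
  mul_rt : r * t = v * s
  mul_st : s * t = w * r
  sq_r : r ^ 2 = u * v
  sq_s : s ^ 2 = u * w
  sq_t : t ^ 2 = v * w
  indep : ∀ a b c d : ℚ, (a : K) + b * r + c * s + d * t = 0 → a = 0 ∧ b = 0 ∧ c = 0 ∧ d = 0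
  span : ∀ x : K, ∃ a b c d : ℚ, x = a + b * r + c * s + d * t

theorem exists_int_of_isIntegral_ratCast {K : Type*} [Field K] [CharZero K] {q : ℚ}
    (h : IsIntegral ℤ (q : K)) : ∃ n : ℤ, q = n := by
  have h1 : IsIntegral ℤ (algebraMap ℚ K q) := by simpa using h
  rw [isIntegral_algebraMap_iff (algebraMap ℚ K).injective] at h1
  obtain ⟨n, hn⟩ := IsIntegrallyClosed.isIntegral_iff.mp h1
  exact ⟨n, by simpa using hn.symm⟩

/-- The squared denominator of `q` is coprime to the squared numerator, so it must divide `d`;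
squarefreeness makes it 1. -/
theorem exists_int_of_squarefree_mul_sq {d : ℕ} (hd : Squarefree d) {q : ℚ} {m : ℤ}
    (h : (d : ℚ) * q ^ 2 = m) : ∃ n : ℤ, q = n := by
  have hden : (q.den : ℚ) ≠ 0 := by exact_mod_cast q.den_nz
  have h1 : (d : ℤ) * q.num ^ 2 = m * (q.den : ℤ) ^ 2 := by
    have h2 : (d : ℚ) * q.num ^ 2 = m * (q.den : ℚ) ^ 2 := by
      rw [← h]
      nth_rewrite 2 [← Rat.num_div_den q]
      field_simp
    exact_mod_cast h2
  have h3 : (q.den : ℤ) ^ 2 ∣ (d : ℤ) := by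
    have hc : IsCoprime ((q.den : ℤ) ^ 2) (q.num ^ 2) := by
      apply IsCoprime.pow
      rw [Int.isCoprime_iff_nat_coprime]
      simpa using q.reduced.symm
    exact hc.dvd_of_dvd_mul_right (Dvd.intro_left _ h1.symm)
  have h4 : q.den * q.den ∣ d := by
    rw [← pow_two]
    exact_mod_cast h3
  have h5 : q.den = 1 := Nat.isUnit_iff.mp (hd _ h4)
  exact ⟨q.num, (Rat.den_eq_one_iff q).mp h5 |>.symm⟩

namespace BiquadraticFrame

variable {K : Type*} [Field K] [CharZero K] {u v w : ℕ} {r s t : K}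

/-- With `swap_st`, this generates all permutations of `u, v, w`, so what is proved for `r`
transfers to `s` and `t`. -/
theorem swap_rs (h : BiquadraticFrame u v w r s t) : BiquadraticFrame u w v s r t where
  mul_rs := by rw [mul_comm, h.mul_rs]
  mul_rt := h.mul_st
  mul_st := h.mul_rt
  sq_r := h.sq_s
  sq_s := h.sq_r
  sq_t := by rw [h.sq_t, mul_comm]
  indep a b c d hz := by
    obtain ⟨h1, h2, h3, h4⟩ := h.indep a c b d (by linear_combination hz)
    exact ⟨h1, h3, h2, h4⟩
  span x := by
    obtain ⟨a, b, c, d, hx⟩ := h.span x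
    exact ⟨a, c, b, d, by rw [hx]; ring⟩

theorem swap_st (h : BiquadraticFrame u v w r s t) : BiquadraticFrame v u w r t s where
  mul_rs := h.mul_rt
  mul_rt := h.mul_rs
  mul_st := by rw [mul_comm, h.mul_st]
  sq_r := by rw [h.sq_r, mul_comm]
  sq_s := h.sq_t
  sq_t := h.sq_s
  indep a b c d hz := by
    obtain ⟨h1, h2, h3, h4⟩ := h.indep a b d c (by linear_combination hz)
    exact ⟨h1, h2, h4, h3⟩
  span x := by
    obtain ⟨a, b, c, d, hx⟩ := h.span x
    exact ⟨a, b, d, c, by rw [hx]; ring⟩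

/-- The `ℚ`-basis `1, r, s, t`. -/
noncomputable def basis (h : BiquadraticFrame u v w r s t) : Module.Basis (Fin 4) ℚ K :=
  Module.Basis.mk (v := ![1, r, s, t])
    (by
      rw [Fintype.linearIndependent_iff]
      intro g hg
      simp only [Fin.sum_univ_four, Rat.smul_def] at hg
      obtain ⟨h0, h1, h2, h3⟩ := h.indep (g 0) (g 1) (g 2) (g 3) (by simpa using hg)
      intro i
      fin_cases i <;> assumption)
    (by
      intro x _
      obtain ⟨a, b, c, d, rfl⟩ := h.span x
      rw [Submodule.mem_span_range_iff_exists_fun]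
      exact ⟨![a, b, c, d], by simp [Fin.sum_univ_four, Rat.smul_def]⟩)

theorem coe_basis (h : BiquadraticFrame u v w r s t) : ⇑h.basis = ![1, r, s, t] :=
  Module.Basis.coe_mk _ _

theorem finrank_eq (h : BiquadraticFrame u v w r s t) : Module.finrank ℚ K = 4 := by
  simpa using Module.finrank_eq_card_basis h.basis

theorem mul_formula (h : BiquadraticFrame u v w r s t) (a b c d a' b' c' d' : K) :
    (a + b * r + c * s + d * t) * (a' + b' * r + c' * s + d' * t) =
      (a * a' + b * b' * (u * v) + c * c' * (u * w) + d * d' * (v * w)) +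
      (a * b' + a' * b + (c * d' + d * c') * w) * r +
      (a * c' + a' * c + (b * d' + d * b') * v) * s +
      (a * d' + a' * d + (b * c' + c * b') * u) * t := by
  linear_combination (b * b') * h.sq_r + (c * c') * h.sq_s + (d * d') * h.sq_t +
    (b * c' + c * b') * h.mul_rs + (b * d' + d * b') * h.mul_rt + (c * d' + d * c') * h.mul_st

/-- Changing the signs of `s` and `t` preserves the multiplication table; multiplicativity is
`mul_formula` with `c, d, c', d'` negated. -/
theorem exists_conj (h : BiquadraticFrame u v w r s t) :
    ∃ σ : K →ₐ[ℚ] K, σ r = r ∧ σ s = -s ∧ σ t = -t := by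
  let L : K →ₗ[ℚ] K := h.basis.constr ℚ ![1, r, -s, -t]
  have hL (i : Fin 4) : L (![1, r, s, t] i) = ![1, r, -s, -t] i := by
    rw [← h.coe_basis]
    exact h.basis.constr_basis _ _ i
  have h0 : L 1 = 1 := hL 0
  have h1 : L r = r := hL 1
  have h2 : L s = -s := hL 2
  have h3 : L t = -t := hL 3
  have hform (a b c d : ℚ) : L (a + b * r + c * s + d * t) = a + b * r - c * s - d * t := by
    have : (a : K) + b * r + c * s + d * t = a • (1 : K) + b • r + c • s + d • t := by
      simp [Rat.smul_def]
    rw [this]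
    simp only [map_add, map_smul, h0, h1, h2, h3]
    simp only [Rat.smul_def]
    ring
  refine ⟨AlgHom.ofLinearMap L h0 fun x y ↦ ?_, h1, h2, h3⟩
  obtain ⟨a, b, c, d, rfl⟩ := h.span x
  obtain ⟨a', b', c', d', rfl⟩ := h.span y
  have key := hform (a * a' + b * b' * (u * v) + c * c' * (u * w) + d * d' * (v * w))
    (a * b' + a' * b + (c * d' + d * c') * w) (a * c' + a' * c + (b * d' + d * b') * v)
    (a * d' + a' * d + (b * c' + c * b') * u)
  push_cast at key
  rw [h.mul_formula, key, hform, hform]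
  have := h.mul_formula a b (-c) (-d) a' b' (-c') (-d')
  linear_combination -this

theorem isIntegral_conj (h : BiquadraticFrame u v w r s t) {a b c d : ℚ}
    (hi : IsIntegral ℤ ((a : K) + b * r + c * s + d * t)) :
    IsIntegral ℤ ((a : K) + b * r - c * s - d * t) := by
  obtain ⟨σ, h1, h2, h3⟩ := h.exists_conj
  have := hi.map (σ.restrictScalars ℤ)
  convert this using 1
  simp [h1, h2, h3]
  ring

/-- Integrality in the quadratic subfield `ℚ(r)`. -/
theorem isIntegral_quadratic (h : BiquadraticFrame u v w r s t) (huv : Squarefree (u * v))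
    {a b : ℚ} (hi : IsIntegral ℤ ((a : K) + b * r)) :
    ∃ A B : ℤ, 2 * a = A ∧ 2 * b = B ∧ (4 : ℤ) ∣ A ^ 2 - u * v * B ^ 2 := by
  have hc : IsIntegral ℤ ((a : K) - b * r) := by
    have := h.swap_rs.isIntegral_conj (a := a) (b := 0) (c := b) (d := 0) (by simpa using hi)
    simpa using this
  obtain ⟨A, hA⟩ := exists_int_of_isIntegral_ratCast (K := K) (q := 2 * a) (by
    rw [show ((2 * a : ℚ) : K) = (a + b * r) + (a - b * r) by push_cast; ring]
    exact hi.add hc)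
  obtain ⟨n, hn⟩ := exists_int_of_isIntegral_ratCast (K := K) (q := a ^ 2 - u * v * b ^ 2) (by
    rw [show ((a ^ 2 - u * v * b ^ 2 : ℚ) : K) = (a + b * r) * (a - b * r) by
      push_cast
      linear_combination (b : K) ^ 2 * h.sq_r]
    exact hi.mul hc)
  -- Trace `A` and norm `n` are integers and `uv (2b)² = A² - 4n`, so `2b` has no denominator.
  obtain ⟨B, hB⟩ := exists_int_of_squarefree_mul_sq huv (q := 2 * b) (m := A ^ 2 - 4 * n) (by
    push_cast
    rw [← hA, ← hn]
    ring)
  refine ⟨A, B, hA, hB, n, ?_⟩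
  have : (A : ℚ) ^ 2 - u * v * B ^ 2 = 4 * n := by rw [← hA, ← hB, ← hn]; ring
  exact_mod_cast this

/-- Adding the conjugate over `ℚ(r)` leaves `2a + 2br`, an integer of that quadratic field. Doing
this in all three quadratic subfields gives denominators at most 4; the three values of `A` coincide
since each is `4a`. -/
theorem isIntegral_quarter (h : BiquadraticFrame u v w r s t) (huv : Squarefree (u * v))
    (huw : Squarefree (u * w)) (hvw : Squarefree (v * w))
    {a b c d : ℚ} (hi : IsIntegral ℤ ((a : K) + b * r + c * s + d * t)) :
    ∃ A B C D : ℤ, 4 * a = A ∧ 4 * b = B ∧ 4 * c = C ∧ 4 * d = D ∧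
      (4 : ℤ) ∣ A ^ 2 - u * v * B ^ 2 ∧ (4 : ℤ) ∣ A ^ 2 - u * w * C ^ 2 ∧
      (4 : ℤ) ∣ A ^ 2 - v * w * D ^ 2 := by
  have half {u v w : ℕ} {r s t : K} (h : BiquadraticFrame u v w r s t) (huv : Squarefree (u * v))
      {a b c d : ℚ} (hi : IsIntegral ℤ ((a : K) + b * r + c * s + d * t)) :
      ∃ A B : ℤ, 4 * a = A ∧ 4 * b = B ∧ (4 : ℤ) ∣ A ^ 2 - u * v * B ^ 2 := by
    have h1 := hi.add (h.isIntegral_conj hi)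
    obtain ⟨A, B, hA, hB, hAB⟩ := h.isIntegral_quadratic huv (a := 2 * a) (b := 2 * b) (by
      rw [show ((2 * a : ℚ) : K) + (2 * b : ℚ) * r =
        (a + b * r + c * s + d * t) + (a + b * r - c * s - d * t) by push_cast; ring]
      exact h1)
    exact ⟨A, B, by rw [← hA]; ring, by rw [← hB]; ring, hAB⟩
  obtain ⟨A, B, hA, hB, hAB⟩ := half h huv hi
  obtain ⟨A', C, hA', hC, hAC⟩ := half h.swap_rs huw (a := a) (b := c) (c := b) (d := d) (by
    convert hi using 1; ring)
  obtain ⟨A'', D, hA'', hD, hAD⟩ := half h.swap_st.swap_rs hvw (a := a) (b := d) (c := b) (d := c)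
    (by convert hi using 1; ring)
  have e1 : A' = A := by exact_mod_cast hA'.symm.trans hA
  have e2 : A'' = A := by exact_mod_cast hA''.symm.trans hA
  subst e1 e2
  exact ⟨_, B, C, D, hA, hB, hC, hD, hAB, hAC, hAD⟩

/-- Some automorphism sends `r` to `-r`, and the trace is invariant. -/
theorem trace_r (h : BiquadraticFrame u v w r s t) : Algebra.trace ℚ K r = 0 := by
  have : FiniteDimensional ℚ K := Module.Basis.finiteDimensional_of_finite h.basis
  obtain ⟨σ, h1, h2, h3⟩ := h.swap_rs.exists_conj
  have := Algebra.trace_eq_of_algEquiv (AlgEquiv.ofBijective σ σ.bijective) r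
  simp only [AlgEquiv.coe_ofBijective, h2, map_neg] at this
  linarith

theorem trace_eq (h : BiquadraticFrame u v w r s t) (a b c d : ℚ) :
    Algebra.trace ℚ K (a + b * r + c * s + d * t) = 4 * a := by
  have h1 : (a : K) + b * r + c * s + d * t =
      algebraMap ℚ K a + b • r + c • s + d • t := by simp [Rat.smul_def]
  rw [h1]
  simp only [map_add, map_smul, Algebra.trace_algebraMap, h.finrank_eq, h.trace_r,
    h.swap_rs.trace_r, h.swap_st.swap_rs.trace_r]
  simp

/-- The basis is orthogonal for the trace form, with diagonal entries `4, 4uv, 4uw, 4vw`. -/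
theorem discr_basis (h : BiquadraticFrame u v w r s t) :
    Algebra.discr ℚ h.basis = 256 * ((u : ℚ) * v * w) ^ 2 := by
  have hM : Algebra.traceMatrix ℚ h.basis =
      Matrix.diagonal ![4, 4 * ((u : ℚ) * v), 4 * ((u : ℚ) * w), 4 * ((v : ℚ) * w)] := by
    have T (x : K) (a b c d : ℚ) (hx : x = a + b * r + c * s + d * t) :
        Algebra.trace ℚ K x = 4 * a := by rw [hx, h.trace_eq]
    ext i j
    rw [Algebra.traceMatrix_apply, Algebra.traceForm_apply, h.coe_basis]
    fin_cases i <;> fin_cases j <;>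
      simp only [Fin.reduceFinMk, Fin.zero_eta, Fin.mk_one, Matrix.cons_val,
        Matrix.diagonal_apply_eq, ne_eq, Fin.reduceEq, not_false_eq_true,
        Matrix.diagonal_apply_ne]
    · rw [T _ 1 0 0 0 (by simp)]; norm_num
    · rw [T _ 0 1 0 0 (by simp)]; norm_num
    · rw [T _ 0 0 1 0 (by simp)]; norm_num
    · rw [T _ 0 0 0 1 (by simp)]; norm_num
    · rw [T _ 0 1 0 0 (by simp)]; norm_num
    · rw [T _ (u * v) 0 0 0 (by simp [← h.sq_r, pow_two])]
    · rw [T _ 0 0 0 u (by simp [h.mul_rs])]; norm_num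
    · rw [T _ 0 0 v 0 (by simp [h.mul_rt])]; norm_num
    · rw [T _ 0 0 1 0 (by simp)]; norm_num
    · rw [T _ 0 0 0 u (by simp [mul_comm s, h.mul_rs])]; norm_num
    · rw [T _ (u * w) 0 0 0 (by simp [← h.sq_s, pow_two])]
    · rw [T _ 0 w 0 0 (by simp [h.mul_st])]; norm_num
    · rw [T _ 0 0 0 1 (by simp)]; norm_num
    · rw [T _ 0 0 v 0 (by simp [mul_comm t, h.mul_rt])]; norm_num
    · rw [T _ 0 w 0 0 (by simp [mul_comm t, h.mul_st])]; norm_num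
    · rw [T _ (v * w) 0 0 0 (by simp [← h.sq_t, pow_two])]
  rw [Algebra.discr_def, hM, Matrix.det_diagonal, Fin.prod_univ_four]
  simp only [Matrix.cons_val]
  ring

end BiquadraticFrame

/-! ### Integral bases and the discriminant. -/

theorem isIntegral_of_sq_eq {K : Type*} [CommRing K] {x : K} (m n : ℤ)
    (h : x ^ 2 = m * x + n) : IsIntegral ℤ x := by
  refine ⟨Polynomial.X ^ 2 + (-Polynomial.C m * Polynomial.X + -Polynomial.C n),
    Polynomial.monic_X_pow_add ?_, ?_⟩
  · rw [← Polynomial.C_neg, ← Polynomial.C_neg]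
    exact (Polynomial.degree_linear_le).trans_lt (by norm_num)
  · simp only [Polynomial.eval₂_add, Polynomial.eval₂_mul, Polynomial.eval₂_neg,
      Polynomial.eval₂_C, Polynomial.eval₂_X, Polynomial.eval₂_X_pow, h]
    simp only [eq_intCast]
    ring

theorem isIntegral_of_eq {K : Type*} [CommRing K] {x y : K} (hx : IsIntegral ℤ x) (h : y = x) :
    IsIntegral ℤ y := h ▸ hx

/-- Squares are 0 or 1 mod 4. This and the next lemma are the parity conditions separating the rings
of integers for `d ≡ 1` and `d ≡ 3` mod 4. -/
theorem int_odd_iff_of_four_dvd_of_one_mod_four {A B d : ℤ} (hd : d % 4 = 1)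
    (h : (4 : ℤ) ∣ A ^ 2 - d * B ^ 2) : A % 2 = B % 2 := by
  obtain ⟨k, hk⟩ := h
  obtain ⟨m, rfl⟩ : ∃ m, d = 4 * m + 1 := ⟨d / 4, by omega⟩
  rcases Int.emod_two_eq_zero_or_one A with hA | hA <;>
    rcases Int.emod_two_eq_zero_or_one B with hB | hB
  · rw [hA, hB]
  · exfalso
    obtain ⟨a, rfl⟩ : ∃ a, A = 2 * a := ⟨A / 2, by omega⟩
    obtain ⟨b, rfl⟩ : ∃ b, B = 2 * b + 1 := ⟨B / 2, by omega⟩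
    ring_nf at hk; omega
  · exfalso
    obtain ⟨a, rfl⟩ : ∃ a, A = 2 * a + 1 := ⟨A / 2, by omega⟩
    obtain ⟨b, rfl⟩ : ∃ b, B = 2 * b := ⟨B / 2, by omega⟩
    ring_nf at hk; omega
  · rw [hA, hB]

theorem int_even_of_four_dvd_of_three_mod_four {A B d : ℤ} (hd : d % 4 = 3)
    (h : (4 : ℤ) ∣ A ^ 2 - d * B ^ 2) : A % 2 = 0 ∧ B % 2 = 0 := by
  obtain ⟨k, hk⟩ := h
  obtain ⟨m, rfl⟩ : ∃ m, d = 4 * m + 3 := ⟨d / 4, by omega⟩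
  rcases Int.emod_two_eq_zero_or_one A with hA | hA <;>
    rcases Int.emod_two_eq_zero_or_one B with hB | hB
  · exact ⟨hA, hB⟩
  · exfalso
    obtain ⟨a, rfl⟩ : ∃ a, A = 2 * a := ⟨A / 2, by omega⟩
    obtain ⟨b, rfl⟩ : ∃ b, B = 2 * b + 1 := ⟨B / 2, by omega⟩
    ring_nf at hk; omega
  · exfalso
    obtain ⟨a, rfl⟩ : ∃ a, A = 2 * a + 1 := ⟨A / 2, by omega⟩
    obtain ⟨b, rfl⟩ : ∃ b, B = 2 * b := ⟨B / 2, by omega⟩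
    ring_nf at hk; omega
  · exfalso
    obtain ⟨a, rfl⟩ : ∃ a, A = 2 * a + 1 := ⟨A / 2, by omega⟩
    obtain ⟨b, rfl⟩ : ∃ b, B = 2 * b + 1 := ⟨B / 2, by omega⟩
    ring_nf at hk; omega

theorem nat_mul_mod_four_eq_one {u v : ℕ} (hu : Odd u) (h : u % 4 = v % 4) : u * v % 4 = 1 := by
  have hu' := Nat.odd_iff.mp hu
  have : u % 4 = 1 ∨ u % 4 = 3 := by omega
  rcases this with h1 | h1 <;> rw [Nat.mul_mod, ← h, h1]

theorem nat_mul_mod_four_eq_three {u v : ℕ} (hu : Odd u) (hv : Odd v) (h : u % 4 ≠ v % 4) :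
    u * v % 4 = 3 := by
  have hu' := Nat.odd_iff.mp hu
  have hv' := Nat.odd_iff.mp hv
  have : u % 4 = 1 ∧ v % 4 = 3 ∨ u % 4 = 3 ∧ v % 4 = 1 := by omega
  rcases this with ⟨h1, h2⟩ | ⟨h1, h2⟩ <;> rw [Nat.mul_mod, h1, h2]

namespace BiquadraticFrame

variable {K : Type*} [Field K] {u v w : ℕ} {r s t : K}

/-- The discriminant, given a `ℤ`-basis of the ring of integers in terms of `1, r, s, t`. -/
theorem discr_eq_of_matrix [NumberField K] (h : BiquadraticFrame u v w r s t)
    (h0 : u * v * w ≠ 0) (P : Matrix (Fin 4) (Fin 4) ℚ) (hP : P.det ≠ 0) (b : Fin 4 → K)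
    (hb : b = (P.map (algebraMap ℚ K)).mulVec h.basis)
    (hint : ∀ i, IsIntegral ℤ (b i))
    (hspan : ∀ x : K, IsIntegral ℤ x → ∃ n : Fin 4 → ℤ, x = ∑ i, (n i : K) * b i) :
    (NumberField.discr K : ℚ) = P.det ^ 2 * (256 * ((u : ℚ) * v * w) ^ 2) := by
  have hdisc : Algebra.discr ℚ b = P.det ^ 2 * (256 * ((u : ℚ) * v * w) ^ 2) := by
    rw [hb, Algebra.discr_of_matrix_mulVec, h.discr_basis]
  have hli : LinearIndependent ℚ b := by
    by_contra hli
    have := Algebra.discr_zero_of_not_linearIndependent ℚ hli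
    rw [hdisc] at this
    have h0' : (u : ℚ) * v * w ≠ 0 := by exact_mod_cast h0
    exact (by positivity : P.det ^ 2 * (256 * ((u : ℚ) * v * w) ^ 2) ≠ 0) this
  let B := basisOfLinearIndependentOfCardEqFinrank hli (by rw [h.finrank_eq]; simp)
  have hB : ⇑B = b := coe_basisOfLinearIndependentOfCardEqFinrank _ _
  rw [NumberField.coe_discr, ← hdisc, ← hB]
  symm
  -- Both transition matrices to and from the standard integral basis have integral entries, so the
  -- two discriminants agree.
  apply Algebra.discr_eq_discr_of_toMatrix_coeff_isIntegral
  · intro i j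
    rw [Module.Basis.toMatrix_apply]
    obtain ⟨n, hn⟩ := hspan (NumberField.integralBasis K j) (by
      rw [NumberField.integralBasis_apply]
      exact NumberField.RingOfIntegers.isIntegral_coe _)
    have : NumberField.integralBasis K j = ∑ i, (n i : ℚ) • B i := by
      rw [hn, hB]
      simp [Rat.smul_def]
    rw [this, Module.Basis.repr_sum_self]
    exact isIntegral_algebraMap (R := ℤ) (A := ℚ)
  · intro i j
    rw [Module.Basis.toMatrix_apply, hB]
    obtain ⟨y, hy⟩ := (IsIntegralClosure.isIntegral_iff
      (A := NumberField.RingOfIntegers K)).mp (hint j)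
    rw [← hy, NumberField.integralBasis_repr_apply]
    exact isIntegral_algebraMap

theorem isIntegral_half [CharZero K] (h : BiquadraticFrame u v w r s t) (huv : u * v % 4 = 1) :
    IsIntegral ℤ ((1 + r) / 2) := by
  obtain ⟨k, hk⟩ : ∃ k : ℕ, u * v = 4 * k + 1 := ⟨u * v / 4, by omega⟩
  have hk' : (u : K) * v = 4 * k + 1 := by exact_mod_cast hk
  refine isIntegral_of_sq_eq 1 k ?_
  push_cast
  linear_combination (1 / 4 : K) * h.sq_r + (1 / 4 : K) * hk'

/-- Here `uv, uw, vw ≡ 1` mod 4. With `ε = ±1`, `ε ≡ u` mod 4, an integral basis is `1, (1+r)/2,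
(1+s)/2, (1+r+s+εt)/4`. Its transition determinant `ε/16` cancels the factor 256. -/
theorem discr_of_congr [NumberField K] (h : BiquadraticFrame u v w r s t)
    (hodd : Odd (u * v * w)) (hsq : Squarefree (u * v * w)) (h1 : u % 4 = v % 4)
    (h2 : v % 4 = w % 4) : NumberField.discr K = ((u : ℤ) * v * w) ^ 2 := by
  have hou : Odd u := Nat.Odd.of_mul_left (Nat.Odd.of_mul_left hodd)
  have hov : Odd v := Nat.Odd.of_mul_right (Nat.Odd.of_mul_left hodd)
  have huv : Squarefree (u * v) := hsq.squarefree_of_dvd (Dvd.intro _ rfl)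
  have huw : Squarefree (u * w) := hsq.squarefree_of_dvd ⟨v, by ring⟩
  have hvw : Squarefree (v * w) := hsq.squarefree_of_dvd ⟨u, by ring⟩
  have muv := nat_mul_mod_four_eq_one hou h1
  have muw := nat_mul_mod_four_eq_one hou (h1.trans h2)
  have mvw := nat_mul_mod_four_eq_one hov h2
  have ir := h.isIntegral_half muv
  have is := h.swap_rs.isIntegral_half muw
  have it : IsIntegral ℤ t := isIntegral_of_sq_eq 0 (v * w) (by push_cast; rw [h.sq_t]; ring)
  obtain ⟨ε, k, hε, huk⟩ : ∃ ε k : ℤ, ε * ε = 1 ∧ (u : ℤ) = 4 * k + ε := by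
    have := Nat.odd_iff.mp hou
    have h3 : u % 4 = 1 ∨ u % 4 = 3 := by omega
    rcases h3 with h3 | h3
    · exact ⟨1, u / 4, by norm_num, by omega⟩
    · exact ⟨-1, (u + 1) / 4, by norm_num, by omega⟩
  have huk' : (u : K) = 4 * k + ε := by exact_mod_cast congrArg (Int.cast (R := K)) huk
  have hε' : (ε : K) * ε = 1 := by exact_mod_cast congrArg (Int.cast (R := K)) hε
  have hεQ : (ε : ℚ) * ε = 1 := by exact_mod_cast hε
  have iq : IsIntegral ℤ ((1 + r + s + ε * t) / 4) := by
    have hkt : IsIntegral ℤ ((k : K) * t) := by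
      have := (isIntegral_algebraMap (R := ℤ) (A := K) (x := k)).mul it
      simpa using this
    -- The product `(1+r)/2 · (1+s)/2` is `(1+r+s+ut)/4`, and `u = 4k + ε`.
    rw [show (1 + r + s + ε * t) / 4 = (1 + r) / 2 * ((1 + s) / 2) - k * t by
      linear_combination (-1 / 4 : K) * h.mul_rs - (1 / 4 : K) * t * huk']
    exact (ir.mul is).sub hkt
  let P : Matrix (Fin 4) (Fin 4) ℚ :=
    !![1, 0, 0, 0; 1/2, 1/2, 0, 0; 1/2, 0, 1/2, 0; 1/4, 1/4, 1/4, (ε : ℚ)/4]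
  have hdet : P.det = ε / 16 := by
    simp [P, Matrix.det_succ_row_zero, Fin.sum_univ_succ, Fin.succAbove]
    ring
  have hε0 : (ε : ℚ) ≠ 0 := by rintro h0; rw [h0] at hεQ; norm_num at hεQ
  have key := h.discr_eq_of_matrix hsq.ne_zero P (by rw [hdet]; simpa using hε0)
    ![1, (1 + r) / 2, (1 + s) / 2, (1 + r + s + ε * t) / 4]
    (by
      rw [h.coe_basis]
      ext i
      fin_cases i <;> simp [P, Matrix.mulVec, dotProduct, Fin.sum_univ_four] <;> ring)
    (by
      intro i
      fin_cases i
      · exact isIntegral_one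
      · exact ir
      · exact is
      · exact iq)
    (by
      intro x hx
      obtain ⟨a, b, c, d, rfl⟩ := h.span x
      obtain ⟨A, B, C, D, hA, hB, hC, hD, hAB, hAC, hAD⟩ := h.isIntegral_quarter huv huw hvw hx
      have pB := int_odd_iff_of_four_dvd_of_one_mod_four (d := u * v) (by exact_mod_cast muv) hAB
      have pC := int_odd_iff_of_four_dvd_of_one_mod_four (d := u * w) (by exact_mod_cast muw) hAC
      have pD := int_odd_iff_of_four_dvd_of_one_mod_four (d := v * w) (by exact_mod_cast mvw) hAD
      have pεD : (ε * D) % 2 = D % 2 := by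
        have : ε % 2 = 1 := by
          have := Nat.odd_iff.mp hou
          omega
        rw [Int.mul_emod, this, one_mul, Int.emod_emod_of_dvd _ (dvd_refl 2)]
      -- Coordinates are found from the last one down: `εD` copies of the fourth element remove `t`
      -- because `ε² = 1`, then `m` and `n` remove `r` and `s`. What remains is an integral
      -- rational.
      obtain ⟨m, hm⟩ : ∃ m, B - ε * D = 2 * m := ⟨(B - ε * D) / 2, by omega⟩
      obtain ⟨n, hn⟩ : ∃ n, C - ε * D = 2 * n := ⟨(C - ε * D) / 2, by omega⟩
      have hmK : (4 * b : K) - ε * (4 * d) = 2 * m := by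
        have : (4 * b) - ε * (4 * d) = 2 * m := by rw [hB, hD]; exact_mod_cast hm
        exact_mod_cast congrArg (Rat.cast (K := K)) this
      have hnK : (4 * c : K) - ε * (4 * d) = 2 * n := by
        have : (4 * c) - ε * (4 * d) = 2 * n := by rw [hC, hD]; exact_mod_cast hn
        exact_mod_cast congrArg (Rat.cast (K := K)) this
      have hDK : (4 * d : K) = D := by exact_mod_cast congrArg (Rat.cast (K := K)) hD
      have I (z : ℤ) : IsIntegral ℤ (z : K) := isIntegral_algebraMap (R := ℤ) (A := K) (x := z)
      have hrem : IsIntegral ℤ ((a - m / 2 - n / 2 - ε * D / 4 : ℚ) : K) := by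
        have := ((hx.sub ((I m).mul ir)).sub ((I n).mul is)).sub ((I (ε * D)).mul iq)
        refine isIntegral_of_eq this ?_
        push_cast
        rw [← hDK]
        linear_combination (-r / 4) * hmK - s / 4 * hnK + (d * t) * hε'
      obtain ⟨l, hl⟩ := exists_int_of_isIntegral_ratCast hrem
      have hlK : (a - m / 2 - n / 2 - ε * D / 4 : K) = l := by
        exact_mod_cast congrArg (Rat.cast (K := K)) hl
      refine ⟨![l, m, n, ε * D], ?_⟩
      simp only [Fin.sum_univ_four, Matrix.cons_val]
      push_cast
      rw [← hlK, ← hDK]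
      linear_combination (r / 4) * hmK + (s / 4) * hnK - (d * t) * hε')
  have : (NumberField.discr K : ℚ) = (((u : ℤ) * v * w) ^ 2 : ℤ) := by
    rw [key, hdet]
    push_cast
    linear_combination ((u : ℚ) * v * w) ^ 2 * hεQ
  exact_mod_cast this

/-- Now `uv ≡ 1` and `uw ≡ vw ≡ 3` mod 4. An integral basis is `1, (1+r)/2, s, (s+t)/2`, of
determinant `1/4`, which turns 256 into 16. -/
theorem discr_of_not_congr [NumberField K] (h : BiquadraticFrame u v w r s t)
    (hodd : Odd (u * v * w)) (hsq : Squarefree (u * v * w)) (h1 : u % 4 = v % 4)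
    (h2 : v % 4 ≠ w % 4) : NumberField.discr K = 16 * ((u : ℤ) * v * w) ^ 2 := by
  have hou : Odd u := Nat.Odd.of_mul_left (Nat.Odd.of_mul_left hodd)
  have hov : Odd v := Nat.Odd.of_mul_right (Nat.Odd.of_mul_left hodd)
  have how : Odd w := Nat.Odd.of_mul_right hodd
  have huv : Squarefree (u * v) := hsq.squarefree_of_dvd (Dvd.intro _ rfl)
  have huw : Squarefree (u * w) := hsq.squarefree_of_dvd ⟨v, by ring⟩
  have hvw : Squarefree (v * w) := hsq.squarefree_of_dvd ⟨u, by ring⟩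
  have muv := nat_mul_mod_four_eq_one hou h1
  have muw := nat_mul_mod_four_eq_three hou how (h1 ▸ h2)
  have mvw := nat_mul_mod_four_eq_three hov how h2
  have ir := h.isIntegral_half muv
  have is : IsIntegral ℤ s := isIntegral_of_sq_eq 0 (u * w) (by push_cast; rw [h.sq_s]; ring)
  have I (z : ℤ) : IsIntegral ℤ (z : K) := isIntegral_algebraMap (R := ℤ) (A := K) (x := z)
  have ist : IsIntegral ℤ ((s + t) / 2) := by
    obtain ⟨k, hk⟩ : ∃ k : ℤ, (u : ℤ) + v = 4 * k + 2 := by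
      have := Nat.odd_iff.mp hou
      exact ⟨(u + v) / 4, by omega⟩
    have hk' : (u : K) + v = 4 * k + 2 := by exact_mod_cast congrArg (Int.cast (R := K)) hk
    -- The square of `(s+t)/2` is `w(u+v+2r)/4`, and `u + v = 4k + 2`.
    refine IsIntegral.of_pow (n := 2) (by norm_num) ?_
    rw [show ((s + t) / 2) ^ 2 = ((w : ℤ) : K) * ((k : K) + (1 + r) / 2) by
      push_cast
      linear_combination (1 / 4 : K) * h.sq_s + (1 / 4 : K) * h.sq_t + (1 / 2 : K) * h.mul_st +
        (w / 4 : K) * hk']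
    exact (I _).mul ((I _).add ir)
  let P : Matrix (Fin 4) (Fin 4) ℚ :=
    !![1, 0, 0, 0; 1/2, 1/2, 0, 0; 0, 0, 1, 0; 0, 0, 1/2, 1/2]
  have hdet : P.det = 1 / 4 := by
    simp [P, Matrix.det_succ_row_zero, Fin.sum_univ_succ, Fin.succAbove]
    norm_num
  have key := h.discr_eq_of_matrix hsq.ne_zero P (by rw [hdet]; norm_num)
    ![1, (1 + r) / 2, s, (s + t) / 2]
    (by
      rw [h.coe_basis]
      ext i
      fin_cases i <;> simp [P, Matrix.mulVec, dotProduct, Fin.sum_univ_four] <;> ring)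
    (by
      intro i
      fin_cases i
      · exact isIntegral_one
      · exact ir
      · exact is
      · exact ist)
    (by
      intro x hx
      obtain ⟨a, b, c, d, rfl⟩ := h.span x
      obtain ⟨A, B, C, D, hA, hB, hC, hD, hAB, hAC, hAD⟩ := h.isIntegral_quarter huv huw hvw hx
      have pB := int_odd_iff_of_four_dvd_of_one_mod_four (d := u * v) (by exact_mod_cast muv) hAB
      have pC := int_even_of_four_dvd_of_three_mod_four (d := u * w) (by exact_mod_cast muw) hAC
      have pD := int_even_of_four_dvd_of_three_mod_four (d := v * w) (by exact_mod_cast mvw) hAD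
      obtain ⟨m, rfl⟩ : ∃ m, B = 2 * m := ⟨B / 2, by omega⟩
      obtain ⟨n, rfl⟩ : ∃ n, D = 2 * n := ⟨D / 2, by omega⟩
      have hmK : (4 * b : K) = 2 * m := by exact_mod_cast congrArg (Rat.cast (K := K)) hB
      have hnK : (4 * d : K) = 2 * n := by exact_mod_cast congrArg (Rat.cast (K := K)) hD
      -- Removing the `r` and `t` parts leaves an integer of `ℚ(s)`; since `uw ≡ 3` mod 4, its
      -- coordinates in `1, s` are integers.
      have hrem : IsIntegral ℤ (((a - m / 2 : ℚ) : K) + ((c - n / 2 : ℚ) : K) * s) := by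
        have := (hx.sub ((I m).mul ir)).sub ((I n).mul ist)
        refine isIntegral_of_eq this ?_
        push_cast
        linear_combination (-r / 4) * hmK - t / 4 * hnK
      obtain ⟨A', C', hA', hC', hdvd⟩ := h.swap_rs.isIntegral_quadratic huw hrem
      have pp := int_even_of_four_dvd_of_three_mod_four (d := u * w) (by exact_mod_cast muw) hdvd
      obtain ⟨l, rfl⟩ : ∃ l, A' = 2 * l := ⟨A' / 2, by omega⟩
      obtain ⟨q, rfl⟩ : ∃ q, C' = 2 * q := ⟨C' / 2, by omega⟩
      have hl : (a - m / 2 : K) = l := by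
        have : a - m / 2 = l := by push_cast at hA'; linarith
        exact_mod_cast congrArg (Rat.cast (K := K)) this
      have hq : (c - n / 2 : K) = q := by
        have : c - n / 2 = q := by push_cast at hC'; linarith
        exact_mod_cast congrArg (Rat.cast (K := K)) this
      refine ⟨![l, m, q, n], ?_⟩
      simp only [Fin.sum_univ_four, Matrix.cons_val]
      rw [← hl, ← hq]
      linear_combination (r / 4) * hmK + (t / 4) * hnK)
  have : (NumberField.discr K : ℚ) = (16 * ((u : ℤ) * v * w) ^ 2 : ℤ) := by
    rw [key, hdet]
    push_cast
    ring
  exact_mod_cast this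

/-- The discriminant of the biquadratic field attached to `u, v, w`. -/
theorem discr_eq [NumberField K] (h : BiquadraticFrame u v w r s t)
    (hodd : Odd (u * v * w)) (hsq : Squarefree (u * v * w)) :
    NumberField.discr K =
      (if u % 4 = v % 4 ∧ v % 4 = w % 4 then 1 else 16) * ((u : ℤ) * v * w) ^ 2 := by
  have hou := Nat.odd_iff.mp (Nat.Odd.of_mul_left (Nat.Odd.of_mul_left hodd))
  have hov := Nat.odd_iff.mp (Nat.Odd.of_mul_right (Nat.Odd.of_mul_left hodd))
  have how := Nat.odd_iff.mp (Nat.Odd.of_mul_right hodd)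
  by_cases h1 : u % 4 = v % 4
  · by_cases h2 : v % 4 = w % 4
    · rw [if_pos ⟨h1, h2⟩, h.discr_of_congr hodd hsq h1 h2, one_mul]
    · rw [if_neg (fun hh ↦ h2 hh.2), h.discr_of_not_congr hodd hsq h1 h2]
  · rw [if_neg (fun hh ↦ h1 hh.1)]
    -- There are only two odd classes mod 4, so `w` shares one with `u` or `v`; a permutation brings
    -- that pair to the front.
    by_cases h2 : u % 4 = w % 4
    · have e : u * w * v = u * v * w := by ring
      rw [h.swap_rs.discr_of_not_congr (by rwa [e]) (by rwa [e]) h2 (by omega)]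
      ring
    · have e : v * w * u = u * v * w := by ring
      rw [h.swap_st.swap_rs.discr_of_not_congr (by rwa [e]) (by rwa [e]) (by omega) (by omega)]
      ring

end BiquadraticFrame

/-! ### Square roots, and the fields inside `ℝ`. -/

theorem eq_of_squarefree_of_mul_sq_eq {d e : ℕ} (hd : Squarefree d) (he : Squarefree e) {q : ℚ}
    (h : (e : ℚ) * q ^ 2 = d) : d = e := by
  obtain ⟨n, rfl⟩ := exists_int_of_squarefree_mul_sq he (q := q) (m := d) (by exact_mod_cast h)
  have h1 : e * n.natAbs ^ 2 = d := by
    have : (e : ℤ) * n ^ 2 = d := by exact_mod_cast h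
    zify
    rwa [sq_abs]
  have h2 := Nat.isUnit_iff.mp (hd n.natAbs ⟨e, by rw [← h1]; ring⟩)
  rw [← h1, h2]
  ring

theorem irrational_sqrt_of_squarefree {d : ℕ} (hd : Squarefree d) (h1 : d ≠ 1) :
    Irrational (√(d : ℝ)) := by
  rw [irrational_sqrt_natCast_iff]
  rintro ⟨m, rfl⟩
  have := Nat.isUnit_iff.mp (hd m (dvd_refl _))
  simp [this] at h1

theorem Irrational.eq_zero_of_add_mul_eq_zero {r : ℝ} (hr : Irrational r) {a b : ℚ}
    (h : (a : ℝ) + b * r = 0) : a = 0 ∧ b = 0 := by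
  have hb : b = 0 := by
    by_contra hb
    have hb' : (b : ℝ) ≠ 0 := by exact_mod_cast hb
    exact hr ⟨-a / b, by push_cast; field_simp; linarith⟩
  subst hb
  refine ⟨?_, rfl⟩
  simpa using h

/-- Since `ut = rs`, the relation reads `(ua + ubr) + (uc + dr)s = 0`. If `c, d` are not both 0,
multiplying by `uc - dr` gives `N s = P + Q r` with `N ≠ 0`. Squaring and using the irrationality of
`r` forces `PQ = 0`; then `t` is rational if `P = 0`, and `s` is rational if `Q = 0`. -/
theorem real_indep_of_irrational {r s t : ℝ} {u v w : ℕ} (hu : u ≠ 0) (hr : Irrational r)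
    (hs : Irrational s) (ht : Irrational t) (hrs : r * s = u * t) (hrr : r ^ 2 = u * v)
    (hss : s ^ 2 = u * w) {a b c d : ℚ} (h : (a : ℝ) + b * r + c * s + d * t = 0) :
    a = 0 ∧ b = 0 ∧ c = 0 ∧ d = 0 := by
  have hu' : (u : ℝ) ≠ 0 := by exact_mod_cast hu
  have huQ : (u : ℚ) ≠ 0 := by exact_mod_cast hu
  have h1 : (u * a : ℝ) + u * b * r + (u * c + d * r) * s = 0 := by
    linear_combination u * h + d * hrs
  by_cases hcd : c = 0 ∧ d = 0
  · obtain ⟨rfl, rfl⟩ := hcd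
    obtain ⟨h2, h3⟩ := hr.eq_zero_of_add_mul_eq_zero (a := a) (b := b) (by simpa using h)
    exact ⟨h2, h3, rfl, rfl⟩
  exfalso
  set N : ℚ := (u * c) ^ 2 - d ^ 2 * (u * v) with hN
  set P : ℚ := -(u * a * (u * c)) + u * b * d * (u * v) with hP
  set Q : ℚ := u * a * d - u * b * (u * c) with hQ
  have hNs : (N : ℝ) * s = P + Q * r := by
    rw [hN, hP, hQ]
    push_cast
    linear_combination ((u : ℝ) * c - d * r) * h1 + (u * b * d + d ^ 2 * s) * hrr
  have hN0 : N ≠ 0 := by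
    intro h0
    have : ((u * c : ℚ) + (d : ℚ) * r) * ((u * c : ℚ) + ((-d : ℚ) : ℝ) * r) = 0 := by
      have h0' : ((u * c : ℝ)) ^ 2 - d ^ 2 * (u * v) = 0 := by
        have h0' := congrArg (Rat.cast (K := ℝ)) h0
        rw [hN] at h0'
        push_cast at h0'
        exact h0'
      push_cast
      linear_combination h0' - d ^ 2 * hrr
    rcases mul_eq_zero.mp this with h2 | h2
    · obtain ⟨h3, h4⟩ := hr.eq_zero_of_add_mul_eq_zero h2
      exact hcd ⟨by simpa [hu] using h3, h4⟩
    · obtain ⟨h3, h4⟩ := hr.eq_zero_of_add_mul_eq_zero h2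
      exact hcd ⟨by simpa [hu] using h3, by simpa using h4⟩
  have hN0' : (N : ℝ) ≠ 0 := by exact_mod_cast hN0
  have h2 : ((P ^ 2 + Q ^ 2 * (u * v) - N ^ 2 * (u * w) : ℚ) : ℝ) + ((2 * P * Q : ℚ) : ℝ) * r
      = 0 := by
    push_cast
    linear_combination (-(N : ℝ) * s - (P + Q * r)) * hNs - Q ^ 2 * hrr + N ^ 2 * hss
  have h3 := (hr.eq_zero_of_add_mul_eq_zero h2).2
  rcases mul_eq_zero.mp h3 with h4 | h4
  · have h5 : P = 0 := by simpa using h4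
    rw [h5] at hNs
    apply ht
    refine ⟨Q * v / N, ?_⟩
    push_cast
    rw [div_eq_iff hN0']
    apply mul_left_cancel₀ hu'
    push_cast at hNs
    linear_combination -r * hNs + N * hrs - Q * hrr
  · rw [h4] at hNs
    exact hs ⟨P / N, by push_cast; rw [div_eq_iff hN0']; push_cast at hNs; linarith⟩

/-- In a biquadratic field, the only squarefree integers that are squares are the obvious ones. -/
theorem BiquadraticFrame.eq_of_sq_eq {K : Type*} [Field K] [CharZero K] {u v w : ℕ} {r s t : K}
    (h : BiquadraticFrame u v w r s t) (huv : Squarefree (u * v)) (huw : Squarefree (u * w))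
    (hvw : Squarefree (v * w)) (hvw1 : v * w ≠ 1) {n : ℕ} (hn : Squarefree n)
    (hn1 : n ≠ 1) {x : K} (hx : x ^ 2 = n) : n = u * v ∨ n = u * w ∨ n = v * w := by
  obtain ⟨a, b, c, d, rfl⟩ := h.span x
  rw [pow_two, h.mul_formula] at hx
  obtain ⟨h0, h1, h2, h3⟩ := h.indep
    (a * a + b * b * (u * v) + c * c * (u * w) + d * d * (v * w) - n)
    (a * b + a * b + (c * d + d * c) * w) (a * c + a * c + (b * d + d * b) * v)
    (a * d + a * d + (b * c + c * b) * u) (by push_cast; linear_combination hx)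
  have hne {m : ℕ} (hm : Squarefree m) : (m : ℚ) ≠ 0 := by exact_mod_cast hm.ne_zero
  have huv0 := hne huv
  have huw0 := hne huw
  push_cast at huv0 huw0
  have hu0 := left_ne_zero_of_mul huv0
  have hv0 := right_ne_zero_of_mul huv0
  have hw0 := right_ne_zero_of_mul huw0
  have e1 : a * b = -(c * d * w) := by linarith
  have e2 : a * c = -(b * d * v) := by linarith
  have e3 : a * d = -(b * c * u) := by linarith
  -- The equations `e1`, `e2`, `e3` say that `x²` has no `r, s, t` part. If `a = 0`, at most one of
  -- `b, c, d` survives, giving the three listed values. If `a ≠ 0` and `d = 0`, then `x` is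
  -- rational and `n = 1`. If both are nonzero, so are `b, c`, and `e1 · e2` makes `vw` a rational
  -- square.
  by_cases ha : a = 0
  · subst ha
    have f1 : c * d = 0 := by simpa [hw0] using e1
    have f2 : b * d = 0 := by simpa [hv0] using e2
    have f3 : b * c = 0 := by simpa [hu0] using e3
    by_cases hb : b = 0
    · by_cases hc : c = 0
      · right; right
        refine eq_of_squarefree_of_mul_sq_eq hn hvw (q := d) ?_
        subst hb hc
        push_cast
        linarith
      · right; left
        have hd : d = 0 := by simpa [hc] using f1
        refine eq_of_squarefree_of_mul_sq_eq hn huw (q := c) ?_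
        subst hb hd
        push_cast
        linarith
    · left
      have hd : d = 0 := by simpa [hb] using f2
      have hc : c = 0 := by simpa [hb] using f3
      refine eq_of_squarefree_of_mul_sq_eq hn huv (q := b) ?_
      subst hc hd
      push_cast
      linarith
  · exfalso
    by_cases hd : d = 0
    · have hb : b = 0 := by simpa [hd, ha] using e1
      have hc : c = 0 := by simpa [hd, ha] using e2
      apply hn1
      refine eq_of_squarefree_of_mul_sq_eq hn squarefree_one (q := a) ?_
      subst hb hc hd
      push_cast
      linarith
    · have hbc : b ≠ 0 ∧ c ≠ 0 := by
        constructor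
        · rintro rfl; simp [ha, hd] at e3
        · rintro rfl; simp [ha, hd] at e3
      apply hvw1
      refine (eq_of_squarefree_of_mul_sq_eq squarefree_one hvw (q := d / a) ?_).symm
      have : (a * b) * (a * c) = (c * d * w) * (b * d * v) := by rw [e1, e2]; ring
      have h5 : a ^ 2 = d ^ 2 * (v * w) := by
        apply mul_left_cancel₀ (mul_ne_zero hbc.1 hbc.2)
        linear_combination this
      push_cast
      field_simp
      linarith

/-- The real field `ℚ(√(uv), √(uw), √(vw))`. -/
noncomputable def biquadraticField (u v w : ℕ) : IntermediateField ℚ ℝ :=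
  IntermediateField.adjoin ℚ {√((u * v : ℕ) : ℝ), √((u * w : ℕ) : ℝ), √((v * w : ℕ) : ℝ)}

theorem biquadraticField_swap_right (u v w : ℕ) :
    biquadraticField u w v = biquadraticField u v w := by
  unfold biquadraticField
  rw [Set.insert_comm, mul_comm w v]

theorem biquadraticField_swap_left (u v w : ℕ) :
    biquadraticField v u w = biquadraticField u v w := by
  unfold biquadraticField
  rw [Set.pair_comm, mul_comm v u]

theorem sqrt_mul_sqrt_common (u v w : ℕ) :
    √((u * v : ℕ) : ℝ) * √((u * w : ℕ) : ℝ) = u * √((v * w : ℕ) : ℝ) := by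
  push_cast
  rw [Real.sqrt_mul (by positivity), Real.sqrt_mul (by positivity), Real.sqrt_mul (by positivity)]
  linear_combination √(v : ℝ) * √(w : ℝ) * Real.mul_self_sqrt (Nat.cast_nonneg (α := ℝ) u)

theorem sqrt_natCast_mul_sq (u v : ℕ) : √((u * v : ℕ) : ℝ) ^ 2 = u * v := by
  rw [Real.sq_sqrt (by positivity)]
  push_cast
  ring

theorem isAlgebraic_sqrt_natCast (n : ℕ) : IsAlgebraic ℚ (√(n : ℝ)) := by
  apply IsIntegral.isAlgebraic
  refine IsIntegral.of_pow (n := 2) (by norm_num) ?_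
  rw [Real.sq_sqrt (by positivity)]
  exact isIntegral_algebraMap (R := ℚ) (A := ℝ) (x := n)

/-- Adjoining algebraic elements needs no inverses, and the combinations of `1` and the three roots
are closed under multiplication. -/
theorem mem_biquadraticField {u v w : ℕ} {x : ℝ} (hx : x ∈ biquadraticField u v w) :
    ∃ a b c d : ℚ, x = a + b * √((u * v : ℕ) : ℝ) + c * √((u * w : ℕ) : ℝ) +
      d * √((v * w : ℕ) : ℝ) := by
  have hx' : x ∈ (biquadraticField u v w).toSubalgebra := hx
  rw [biquadraticField, IntermediateField.adjoin_toSubalgebra_of_isAlgebraic] at hx'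
  · clear hx
    induction hx' using Algebra.adjoin_induction with
    | mem x hx =>
      rcases hx with rfl | rfl | rfl
      · exact ⟨0, 1, 0, 0, by simp⟩
      · exact ⟨0, 0, 1, 0, by simp⟩
      · exact ⟨0, 0, 0, 1, by simp⟩
    | algebraMap q => exact ⟨q, 0, 0, 0, by simp⟩
    | add x y _ _ hx hy =>
      obtain ⟨a, b, c, d, rfl⟩ := hx
      obtain ⟨a', b', c', d', rfl⟩ := hy
      exact ⟨a + a', b + b', c + c', d + d', by push_cast; ring⟩
    | mul x y _ _ hx hy =>
      obtain ⟨a, b, c, d, rfl⟩ := hx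
      obtain ⟨a', b', c', d', rfl⟩ := hy
      have m1 := sqrt_mul_sqrt_common u v w
      have m2 := sqrt_mul_sqrt_common v u w
      have m3 := sqrt_mul_sqrt_common w u v
      rw [mul_comm v u] at m2
      rw [mul_comm w u, mul_comm w v] at m3
      have s1 := sqrt_natCast_mul_sq u v
      have s2 := sqrt_natCast_mul_sq u w
      have s3 := sqrt_natCast_mul_sq v w
      refine ⟨a * a' + b * b' * (u * v) + c * c' * (u * w) + d * d' * (v * w),
        a * b' + a' * b + (c * d' + d * c') * w, a * c' + a' * c + (b * d' + d * b') * v,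
        a * d' + a' * d + (b * c' + c * b') * u, ?_⟩
      simp only [Rat.cast_add, Rat.cast_mul, Rat.cast_natCast]
      linear_combination (b * b') * s1 + (c * c') * s2 + (d * d') * s3 +
        (b * c' + c * b') * m1 + (b * d' + d * b') * m2 + (c * d' + d * c') * m3
  · rintro y (rfl | rfl | rfl) <;> exact isAlgebraic_sqrt_natCast _

theorem mul_ne_one_of_ne {u v : ℕ} (h : u ≠ v) : u * v ≠ 1 := by
  intro h1
  exact h ((Nat.eq_one_of_mul_eq_one_right h1).trans (Nat.eq_one_of_mul_eq_one_left h1).symm)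

theorem exists_biquadraticFrame {u v w : ℕ} (hsq : Squarefree (u * v * w)) (huv : u ≠ v)
    (huw : u ≠ w) (hvw : v ≠ w) :
    ∃ r s t : biquadraticField u v w, (r : ℝ) = √((u * v : ℕ) : ℝ) ∧
      (s : ℝ) = √((u * w : ℕ) : ℝ) ∧ (t : ℝ) = √((v * w : ℕ) : ℝ) ∧
      BiquadraticFrame u v w r s t := by
  have hr : √((u * v : ℕ) : ℝ) ∈ biquadraticField u v w :=
    IntermediateField.subset_adjoin _ _ (by simp)
  have hs : √((u * w : ℕ) : ℝ) ∈ biquadraticField u v w :=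
    IntermediateField.subset_adjoin _ _ (by simp)
  have ht : √((v * w : ℕ) : ℝ) ∈ biquadraticField u v w :=
    IntermediateField.subset_adjoin _ _ (by simp)
  have m1 := sqrt_mul_sqrt_common u v w
  have m2 := sqrt_mul_sqrt_common v u w
  have m3 := sqrt_mul_sqrt_common w u v
  rw [mul_comm v u] at m2
  rw [mul_comm w u, mul_comm w v] at m3
  refine ⟨⟨_, hr⟩, ⟨_, hs⟩, ⟨_, ht⟩, rfl, rfl, rfl, ?_⟩
  have squv : Squarefree (u * v) := hsq.squarefree_of_dvd (Dvd.intro _ rfl)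
  have squw : Squarefree (u * w) := hsq.squarefree_of_dvd ⟨v, by ring⟩
  have sqvw : Squarefree (v * w) := hsq.squarefree_of_dvd ⟨u, by ring⟩
  refine ⟨Subtype.ext m1, Subtype.ext m2, Subtype.ext m3, Subtype.ext (sqrt_natCast_mul_sq u v),
    Subtype.ext (sqrt_natCast_mul_sq u w), Subtype.ext (sqrt_natCast_mul_sq v w), ?_, ?_⟩
  · intro a b c d h
    have h' := congrArg (Subtype.val) h
    refine real_indep_of_irrational (left_ne_zero_of_mul squv.ne_zero)
      (irrational_sqrt_of_squarefree squv (mul_ne_one_of_ne huv))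
      (irrational_sqrt_of_squarefree squw (mul_ne_one_of_ne huw))
      (irrational_sqrt_of_squarefree sqvw (mul_ne_one_of_ne hvw)) m1
      (sqrt_natCast_mul_sq u v) (sqrt_natCast_mul_sq u w) (by simpa using h')
  · intro x
    obtain ⟨a, b, c, d, h⟩ := mem_biquadraticField x.2
    exact ⟨a, b, c, d, Subtype.ext (by simpa using h)⟩

theorem finrank_adjoin_sqrt_le (n : ℕ) :
    Module.finrank ℚ (IntermediateField.adjoin ℚ {√(n : ℝ)}) ≤ 2 := by
  rw [IntermediateField.adjoin.finrank (isAlgebraic_sqrt_natCast n).isIntegral]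
  have h1 : minpoly ℚ (√(n : ℝ)) ∣ Polynomial.X ^ 2 - Polynomial.C (n : ℚ) := by
    apply minpoly.dvd
    simp [Real.sq_sqrt]
  have h2 := Polynomial.natDegree_le_of_dvd h1 (Polynomial.X_pow_sub_C_ne_zero (by norm_num) _)
  rwa [Polynomial.natDegree_X_pow_sub_C] at h2

theorem adjoin_one_sqrt (n : ℕ) : IntermediateField.adjoin ℚ {(1 : ℝ), √(n : ℝ)} =
    IntermediateField.adjoin ℚ {√(n : ℝ)} := by
  apply le_antisymm
  · rw [IntermediateField.adjoin_le_iff]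
    rintro x (rfl | rfl)
    · exact one_mem _
    · exact IntermediateField.subset_adjoin _ _ rfl
  · exact IntermediateField.adjoin.mono _ _ _ (by simp)

theorem biquadraticField_eq_adjoin {u v w : ℕ} (hu : u ≠ 0) : biquadraticField u v w =
    IntermediateField.adjoin ℚ {√((u * v : ℕ) : ℝ), √((u * w : ℕ) : ℝ)} := by
  apply le_antisymm
  · rw [biquadraticField, IntermediateField.adjoin_le_iff]
    have h1 : √((u * v : ℕ) : ℝ) ∈
        IntermediateField.adjoin ℚ {√((u * v : ℕ) : ℝ), √((u * w : ℕ) : ℝ)} :=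
      IntermediateField.subset_adjoin _ _ (by simp)
    have h2 : √((u * w : ℕ) : ℝ) ∈
        IntermediateField.adjoin ℚ {√((u * v : ℕ) : ℝ), √((u * w : ℕ) : ℝ)} :=
      IntermediateField.subset_adjoin _ _ (by simp)
    rintro x (rfl | rfl | rfl)
    · exact h1
    · exact h2
    · have hu' : (u : ℝ) ≠ 0 := by exact_mod_cast hu
      have : √((v * w : ℕ) : ℝ) = √((u * v : ℕ) : ℝ) * √((u * w : ℕ) : ℝ) / (u : ℝ) := by
        rw [sqrt_mul_sqrt_common]
        field_simp
      rw [this]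
      exact div_mem (mul_mem h1 h2) (natCast_mem _ u)
  · apply IntermediateField.adjoin.mono
    intro x hx
    simp only [Set.mem_insert_iff, Set.mem_singleton_iff] at hx ⊢
    tauto

/-! ### Fields correspond to sorted triples. -/

/-- The sorted triples with odd squarefree product that parametrise the fields. -/
def sortedTriples : Set (ℕ × ℕ × ℕ) :=
  {p | p.1 < p.2.1 ∧ p.2.1 < p.2.2 ∧ Odd (p.1 * p.2.1 * p.2.2) ∧
    Squarefree (p.1 * p.2.1 * p.2.2)}

/-- The factor `16` occurs in the discriminant unless `u, v, w` agree modulo `4`. -/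
def discrFactor (u v w : ℕ) : ℕ := if u % 4 = v % 4 ∧ v % 4 = w % 4 then 1 else 16

theorem discr_biquadraticField {u v w : ℕ} [NumberField (biquadraticField u v w)]
    (hodd : Odd (u * v * w)) (hsq : Squarefree (u * v * w)) (huv : u < v) (hvw : v < w) :
    |NumberField.discr (biquadraticField u v w)| = (discrFactor u v w * (u * v * w) ^ 2 : ℕ) := by
  obtain ⟨r, s, t, -, -, -, h⟩ := exists_biquadraticFrame hsq huv.ne (huv.trans hvw).ne hvw.ne
  rw [h.discr_eq hodd hsq, abs_of_nonneg (by split_ifs <;> positivity), discrFactor]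
  split_ifs <;> push_cast <;> ring

/-- By `BiquadraticFrame.eq_of_sq_eq` the field determines the set `{uv, uw, vw}`. Sorting gives `uv
< uw < vw`, so the products match one by one, and `u² · vw = uv · uw` recovers `u`. -/
theorem biquadraticField_injOn :
    Set.InjOn (fun p : ℕ × ℕ × ℕ ↦ biquadraticField p.1 p.2.1 p.2.2) sortedTriples := by
  have key {u v w u' v' w' : ℕ} (h1 : u < v) (h2 : v < w) (hsq : Squarefree (u * v * w))
      (h1' : u' < v') (h2' : v' < w') (hsq' : Squarefree (u' * v' * w'))
      (h : biquadraticField u v w = biquadraticField u' v' w') :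
      (u' * v' = u * v ∨ u' * v' = u * w ∨ u' * v' = v * w) ∧
      (u' * w' = u * v ∨ u' * w' = u * w ∨ u' * w' = v * w) ∧
      (v' * w' = u * v ∨ v' * w' = u * w ∨ v' * w' = v * w) := by
    obtain ⟨r, s, t, -, -, -, hf⟩ := exists_biquadraticFrame hsq h1.ne (h1.trans h2).ne h2.ne
    have squv : Squarefree (u * v) := hsq.squarefree_of_dvd (Dvd.intro _ rfl)
    have squw : Squarefree (u * w) := hsq.squarefree_of_dvd ⟨v, by ring⟩
    have sqvw : Squarefree (v * w) := hsq.squarefree_of_dvd ⟨u, by ring⟩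
    have main {n : ℕ} (hn : Squarefree n) (hn1 : n ≠ 1)
        (hmem : √(n : ℝ) ∈ biquadraticField u' v' w') :
        n = u * v ∨ n = u * w ∨ n = v * w := by
      rw [← h] at hmem
      refine hf.eq_of_sq_eq squv squw sqvw (mul_ne_one_of_ne h2.ne) hn hn1 (x := ⟨_, hmem⟩) ?_
      apply Subtype.ext
      simp [Real.sq_sqrt]
    refine ⟨main (hsq'.squarefree_of_dvd (Dvd.intro _ rfl)) (mul_ne_one_of_ne h1'.ne) ?_,
      main (hsq'.squarefree_of_dvd ⟨v', by ring⟩) (mul_ne_one_of_ne (h1'.trans h2').ne) ?_,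
      main (hsq'.squarefree_of_dvd ⟨u', by ring⟩) (mul_ne_one_of_ne h2'.ne) ?_⟩ <;>
    exact IntermediateField.subset_adjoin _ _ (by simp)
  rintro ⟨u, v, w⟩ ⟨h1, h2, -, hsq⟩ ⟨u', v', w'⟩ ⟨h1', h2', -, hsq'⟩ h
  simp only at h1 h2 hsq h1' h2' hsq' h
  have k := key h1 h2 hsq h1' h2' hsq' h
  have hu : 0 < u := Nat.pos_of_ne_zero fun h ↦ hsq.ne_zero (by simp [h])
  have hu' : 0 < u' := Nat.pos_of_ne_zero fun h ↦ hsq'.ne_zero (by simp [h])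
  have o1 : u * v < u * w := Nat.mul_lt_mul_of_pos_left h2 hu
  have o2 : u * w < v * w := Nat.mul_lt_mul_of_pos_right h1 (by omega)
  have o1' : u' * v' < u' * w' := Nat.mul_lt_mul_of_pos_left h2' hu'
  have o2' : u' * w' < v' * w' := Nat.mul_lt_mul_of_pos_right h1' (by omega)
  have e1 : u' * v' = u * v := by omega
  have e2 : u' * w' = u * w := by omega
  have e3 : v' * w' = v * w := by omega
  have e4 : u' = u := by
    have : (u' ^ 2) * (v * w) = u ^ 2 * (v * w) := by
      calc (u' ^ 2) * (v * w) = (u' * v') * (u' * w') := by rw [← e3]; ring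
        _ = u ^ 2 * (v * w) := by rw [e1, e2]; ring
    have hpos : 0 < v * w := Nat.mul_pos (by omega) (by omega)
    have := Nat.eq_of_mul_eq_mul_right (by omega) this
    exact Nat.pow_left_injective (n := 2) (by norm_num) this
  subst e4
  have e5 : v' = v := Nat.eq_of_mul_eq_mul_left hu e1
  have e6 : w' = w := Nat.eq_of_mul_eq_mul_left hu e2
  rw [e5, e6]

theorem biquadraticField_mem {u v w : ℕ} (h : (u, v, w) ∈ sortedTriples) :
    biquadraticField u v w ∈ oddRealBiquadraticFields := by
  obtain ⟨h1, h2, hodd, hsq⟩ := h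
  simp only at h1 h2 hodd hsq
  obtain ⟨r, s, t, -, -, -, hf⟩ := exists_biquadraticFrame hsq h1.ne (h1.trans h2).ne h2.ne
  have hodd' : Odd (u * w * v) := by rwa [mul_right_comm]
  refine ⟨hf.finrank_eq, u * v, u * w, Nat.Odd.of_mul_left hodd, Nat.Odd.of_mul_left hodd',
    hsq.squarefree_of_dvd (Dvd.intro _ rfl), hsq.squarefree_of_dvd ⟨v, by ring⟩,
    biquadraticField_eq_adjoin ?_⟩
  rintro rfl
  simp at hsq

theorem exists_sorted_biquadraticField {u v w : ℕ} (huv : u ≠ v) (huw : u ≠ w) (hvw : v ≠ w)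
    (hodd : Odd (u * v * w)) (hsq : Squarefree (u * v * w)) :
    ∃ p ∈ sortedTriples, biquadraticField p.1 p.2.1 p.2.2 = biquadraticField u v w := by
  wlog h1 : u < v generalizing u v
  · obtain ⟨p, hp, hpe⟩ := this huv.symm hvw huw (by rwa [mul_comm v u])
      (by rwa [mul_comm v u]) (by omega)
    exact ⟨p, hp, by rw [hpe, biquadraticField_swap_left]⟩
  rcases lt_or_gt_of_ne hvw with h2 | h2
  · exact ⟨(u, v, w), ⟨h1, h2, hodd, hsq⟩, rfl⟩
  rcases lt_or_gt_of_ne huw with h3 | h3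
  · have e : u * w * v = u * v * w := by ring
    exact ⟨(u, w, v), ⟨h3, h2, by rwa [e], by rwa [e]⟩, biquadraticField_swap_right u v w⟩
  · have e : w * u * v = u * v * w := by ring
    exact ⟨(w, u, v), ⟨h3, h1, by rwa [e], by rwa [e]⟩, by
      rw [biquadraticField_swap_left, biquadraticField_swap_right]⟩

/-- Squarefreeness makes `g = gcd(a, b)` coprime to both cofactors. A coincidence among `g, v, w`
would mean `a = 1`, `b = 1` or `a = b`, hence degree at most 2. -/
theorem exists_triple_of_mem {K : IntermediateField ℚ ℝ} (hK : K ∈ oddRealBiquadraticFields) :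
    ∃ p ∈ sortedTriples, biquadraticField p.1 p.2.1 p.2.2 = K := by
  obtain ⟨hrank, a, b, ha, hb, hsa, hsb, rfl⟩ := hK
  obtain ⟨v, w, hcop, hv, hw⟩ := Nat.exists_coprime a b
  set g := Nat.gcd a b with hg
  have ea : a = g * v := by rw [mul_comm]; exact hv
  have eb : b = g * w := by rw [mul_comm]; exact hw
  clear_value g
  subst ea eb
  have hg0 : g ≠ 0 := left_ne_zero_of_mul hsa.ne_zero
  have cgv : g.Coprime v := (Nat.squarefree_mul_iff.mp hsa).1
  have cgw : g.Coprime w := (Nat.squarefree_mul_iff.mp hsb).1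
  have hsq : Squarefree (g * v * w) :=
    Nat.squarefree_mul_iff.mpr ⟨Nat.Coprime.mul_left cgw hcop, hsa,
      (Nat.squarefree_mul_iff.mp hsb).2.2⟩
  have hodd : Odd (g * v * w) := ha.mul (Nat.Odd.of_mul_right hb)
  have small (n : ℕ) (h : Module.finrank ℚ (IntermediateField.adjoin ℚ {√(n : ℝ)}) = 4) :
      False := by
    have := finrank_adjoin_sqrt_le n
    omega
  have hgv : g ≠ v := by
    rintro rfl
    have h1 : g = 1 := (Nat.coprime_self g).mp cgv
    subst h1
    rw [show ((1 * 1 : ℕ) : ℝ) = 1 by norm_num, Real.sqrt_one, adjoin_one_sqrt] at hrank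
    exact small _ hrank
  have hgw : g ≠ w := by
    rintro rfl
    have h1 : g = 1 := (Nat.coprime_self g).mp cgw
    subst h1
    rw [Set.pair_comm] at hrank
    rw [show ((1 * 1 : ℕ) : ℝ) = 1 by norm_num, Real.sqrt_one, adjoin_one_sqrt] at hrank
    exact small _ hrank
  have hvw : v ≠ w := by
    rintro rfl
    rw [Set.pair_eq_singleton] at hrank
    exact small _ hrank
  obtain ⟨p, hp, hpe⟩ := exists_sorted_biquadraticField hgv hgw hvw hodd hsq
  exact ⟨p, hp, by rw [hpe, biquadraticField_eq_adjoin hg0]⟩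

/-- The fields with bounded discriminant, parametrised by sorted triples. -/
theorem oddRealBiquadraticFieldsUpTo_eq_image (X : ℝ) :
    oddRealBiquadraticFieldsUpTo X = (fun p : ℕ × ℕ × ℕ ↦ biquadraticField p.1 p.2.1 p.2.2) ''
      {p ∈ sortedTriples |
        ((discrFactor p.1 p.2.1 p.2.2 * (p.1 * p.2.1 * p.2.2) ^ 2 : ℕ) : ℝ) ≤ X} := by
  ext K
  constructor
  · rintro ⟨hK, hN, hd⟩
    obtain ⟨p, hp, rfl⟩ := exists_triple_of_mem hK
    refine ⟨p, ⟨hp, ?_⟩, rfl⟩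
    rw [discr_biquadraticField hp.2.2.1 hp.2.2.2 hp.1 hp.2.1] at hd
    exact_mod_cast hd
  · rintro ⟨p, ⟨hp, hX⟩, rfl⟩
    have hmem := biquadraticField_mem hp
    have : FiniteDimensional ℚ (biquadraticField p.1 p.2.1 p.2.2) :=
      FiniteDimensional.of_finrank_pos (by rw [hmem.1]; norm_num)
    have hN : NumberField (biquadraticField p.1 p.2.1 p.2.2) := ⟨⟩
    refine ⟨hmem, hN, ?_⟩
    rw [discr_biquadraticField hp.2.2.1 hp.2.2.2 hp.1 hp.2.1]
    exact_mod_cast hX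

/-! ### Factoring the weighted count as a small correction convolved with `c * c * ζ`. -/

section DirichletConvolution

open ArithmeticFunction Finset
open scoped ArithmeticFunction.zeta ArithmeticFunction.Moebius

theorem ArithmeticFunction.mul_apply_prime {R : Type*} [Semiring R] (f g : ArithmeticFunction R)
    {p : ℕ} (hp : p.Prime) : (f * g) p = f p * g 1 + f 1 * g p := by
  rw [mul_apply, Nat.sum_divisorsAntidiagonal (fun a b ↦ f a * g b), hp.sum_divisors]
  simp [Nat.div_self hp.pos]

/-- Meant for `g = μ` or `cμ`: only exponents 0 and 1 of `g` contribute. -/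
theorem ArithmeticFunction.mul_apply_prime_pow_succ {R : Type*} [Semiring R]
    (f g : ArithmeticFunction R) {p : ℕ} (hp : p.Prime) (hg : ∀ k, g (p ^ (k + 2)) = 0) (k : ℕ) :
    (f * g) (p ^ (k + 1)) = f (p ^ k) * g p + f (p ^ (k + 1)) * g 1 := by
  have hpow (i j : ℕ) (h : i ≤ j) : p ^ j / p ^ i = p ^ (j - i) := Nat.pow_div h hp.pos
  rw [mul_apply, Nat.sum_divisorsAntidiagonal (fun a b ↦ f a * g b), Nat.divisors_prime_pow hp,
    sum_map, sum_range_succ, sum_range_succ]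
  simp only [Function.Embedding.coeFn_mk]
  rw [sum_eq_zero, hpow k (k + 1) (by omega), hpow (k + 1) (k + 1) le_rfl]
  · simp
  · intro i hi
    rw [mem_range] at hi
    rw [hpow i (k + 1) (by omega), show k + 1 - i = (k - i - 1) + 2 by omega, hg, mul_zero]

theorem ArithmeticFunction.pmul_mul_of_completelyMultiplicative {R : Type*} [CommSemiring R]
    {c : ArithmeticFunction R} (hc : ∀ m n, c (m * n) = c m * c n) (f g : ArithmeticFunction R) :
    c.pmul (f * g) = c.pmul f * c.pmul g := by
  ext n
  simp only [pmul_apply, mul_apply, mul_sum]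
  refine sum_congr rfl fun x hx ↦ ?_
  rw [← (Nat.mem_divisorsAntidiagonal.mp hx).1, hc]
  ring

/-- A completely multiplicative real function bounded by `1`. -/
structure IsBoundedCharacter (c : ArithmeticFunction ℝ) : Prop where
  map_one : c 1 = 1
  map_mul : ∀ m n, c (m * n) = c m * c n
  abs_le : ∀ n, |c n| ≤ 1

theorem IsBoundedCharacter.isMultiplicative {c : ArithmeticFunction ℝ}
    (hc : IsBoundedCharacter c) : c.IsMultiplicative :=
  ⟨hc.map_one, fun _ ↦ hc.map_mul _ _⟩

/-- Multiplying `μ * ζ = 1` pointwise by `c` respects convolution because `c` is completely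
multiplicative. -/
theorem IsBoundedCharacter.pmul_moebius_mul {c : ArithmeticFunction ℝ}
    (hc : IsBoundedCharacter c) :
    c.pmul ((μ : ArithmeticFunction ℤ) : ArithmeticFunction ℝ) * c = 1 := by
  have h := pmul_mul_of_completelyMultiplicative hc.map_mul
    ((μ : ArithmeticFunction ℤ) : ArithmeticFunction ℝ)
    ((ζ : ArithmeticFunction ℕ) : ArithmeticFunction ℝ)
  rw [coe_moebius_mul_coe_zeta, pmul_zeta] at h
  rw [← h]
  ext n
  rw [pmul_apply, one_apply]
  split_ifs with h1
  · simp [h1, hc.map_one]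
  · simp

/-- The indicator function of the odd squarefree numbers. -/
noncomputable def oddSquarefree : ArithmeticFunction ℝ :=
  ⟨fun n ↦ if Odd n ∧ Squarefree n then 1 else 0, by simp⟩

theorem oddSquarefree_apply (n : ℕ) :
    oddSquarefree n = if Odd n ∧ Squarefree n then 1 else 0 := rfl

theorem isMultiplicative_oddSquarefree : oddSquarefree.IsMultiplicative := by
  refine ⟨by simp [oddSquarefree_apply], fun {m n} h ↦ ?_⟩
  simp only [oddSquarefree_apply, Nat.odd_mul, Nat.squarefree_mul_iff]
  by_cases h1 : Odd m ∧ Squarefree m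
  · by_cases h2 : Odd n ∧ Squarefree n
    · rw [if_pos h1, if_pos h2, if_pos (by tauto), one_mul]
    · rw [if_neg h2, if_neg (by tauto), mul_zero]
  · rw [if_neg h1, if_neg (by tauto), zero_mul]

theorem oddSquarefree_two : oddSquarefree 2 = 0 := by
  rw [oddSquarefree_apply, if_neg]
  rintro ⟨h, -⟩
  exact absurd h (by decide)

theorem oddSquarefree_prime {p : ℕ} (hp : p.Prime) (h2 : p ≠ 2) : oddSquarefree p = 1 := by
  rw [oddSquarefree_apply, if_pos ⟨hp.odd_of_ne_two h2, hp.prime.squarefree⟩]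

theorem oddSquarefree_prime_pow {p : ℕ} (hp : p.Prime) (k : ℕ) :
    oddSquarefree (p ^ (k + 2)) = 0 := by
  rw [oddSquarefree_apply, if_neg]
  rintro ⟨-, h⟩
  exact hp.ne_one (Nat.isUnit_iff.mp (h p ⟨p ^ k, by ring⟩))

/-- The weighted number of factorisations `n = uvw`, weighted by `c u * c v`, for `n` odd and
squarefree. -/
noncomputable def weightedTriples (c : ArithmeticFunction ℝ) : ArithmeticFunction ℝ :=
  oddSquarefree.pmul (c * c * ((ζ : ArithmeticFunction ℕ) : ArithmeticFunction ℝ))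

/-- The Dirichlet quotient of `weightedTriples c` by `c * c * ζ`. -/
noncomputable def correction (c : ArithmeticFunction ℝ) : ArithmeticFunction ℝ :=
  weightedTriples c * c.pmul ((μ : ArithmeticFunction ℤ) : ArithmeticFunction ℝ) *
    c.pmul ((μ : ArithmeticFunction ℤ) : ArithmeticFunction ℝ) *
    ((μ : ArithmeticFunction ℤ) : ArithmeticFunction ℝ)

variable {c : ArithmeticFunction ℝ}

theorem correction_mul (hc : IsBoundedCharacter c) :
    correction c * (c * c * ((ζ : ArithmeticFunction ℕ) : ArithmeticFunction ℝ)) =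
      weightedTriples c := by
  unfold correction
  set m := ((μ : ArithmeticFunction ℤ) : ArithmeticFunction ℝ)
  set z := ((ζ : ArithmeticFunction ℕ) : ArithmeticFunction ℝ)
  calc weightedTriples c * c.pmul m * c.pmul m * m * (c * c * z)
      = weightedTriples c * (c.pmul m * c) * (c.pmul m * c) * (m * z) := by ring
    _ = _ := by
      rw [hc.pmul_moebius_mul, coe_moebius_mul_coe_zeta]
      simp

theorem isMultiplicative_weightedTriples (hc : IsBoundedCharacter c) :
    (weightedTriples c).IsMultiplicative :=
  isMultiplicative_oddSquarefree.pmul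
    ((hc.isMultiplicative.mul hc.isMultiplicative).mul isMultiplicative_zeta.natCast)

theorem isMultiplicative_correction (hc : IsBoundedCharacter c) :
    (correction c).IsMultiplicative := by
  have hm : IsMultiplicative ((μ : ArithmeticFunction ℤ) : ArithmeticFunction ℝ) :=
    isMultiplicative_moebius.intCast
  exact (((isMultiplicative_weightedTriples hc).mul (hc.isMultiplicative.pmul hm)).mul
    (hc.isMultiplicative.pmul hm)).mul hm

theorem weightedTriples_prime (hc : IsBoundedCharacter c) {p : ℕ} (hp : p.Prime) :
    weightedTriples c p = oddSquarefree p * (2 * c p + 1) := by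
  rw [weightedTriples, pmul_apply, mul_apply_prime _ _ hp, mul_apply_prime _ _ hp, mul_apply_one,
    hc.map_one]
  simp only [natCoe_apply, zeta_apply, one_ne_zero, hp.ne_zero, if_false, Nat.cast_one]
  ring

theorem weightedTriples_prime_pow {p : ℕ} (hp : p.Prime) (k : ℕ) :
    weightedTriples c (p ^ (k + 2)) = 0 := by
  rw [weightedTriples, pmul_apply, oddSquarefree_prime_pow hp, zero_mul]

theorem moebius_real_prime_pow {p : ℕ} (hp : p.Prime) (k : ℕ) :
    ((μ : ArithmeticFunction ℤ) : ArithmeticFunction ℝ) (p ^ (k + 2)) = 0 := by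
  rw [intCoe_apply, moebius_apply_prime_pow hp (by omega), if_neg (by omega), Int.cast_zero]

theorem mul_pmul_moebius_prime_pow_succ (hc : IsBoundedCharacter c) (f : ArithmeticFunction ℝ)
    {p : ℕ} (hp : p.Prime) (k : ℕ) :
    (f * c.pmul ((μ : ArithmeticFunction ℤ) : ArithmeticFunction ℝ)) (p ^ (k + 1)) =
      f (p ^ (k + 1)) - c p * f (p ^ k) := by
  rw [mul_apply_prime_pow_succ _ _ hp
    (fun k ↦ by rw [pmul_apply, moebius_real_prime_pow hp, mul_zero])]
  simp only [pmul_apply, intCoe_apply, moebius_apply_prime hp, moebius_apply_one, hc.map_one]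
  push_cast
  ring

theorem mul_moebius_prime_pow_succ (f : ArithmeticFunction ℝ) {p : ℕ} (hp : p.Prime) (k : ℕ) :
    (f * ((μ : ArithmeticFunction ℤ) : ArithmeticFunction ℝ)) (p ^ (k + 1)) =
      f (p ^ (k + 1)) - f (p ^ k) := by
  rw [mul_apply_prime_pow_succ _ _ hp (moebius_real_prime_pow hp)]
  simp only [intCoe_apply, moebius_apply_prime hp, moebius_apply_one]
  push_cast
  ring

/-- Values of `correction c` at prime powers, with `q = c p` and `a = weightedTriples c p`. -/
theorem correction_prime_pow (hc : IsBoundedCharacter c) {p : ℕ} (hp : p.Prime) {q a : ℝ}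
    (hq : c p = q) (ha : weightedTriples c p = a) :
    correction c (p ^ 0) = 1 ∧ correction c (p ^ 1) = a - 2 * q - 1 ∧
    correction c (p ^ 2) = q ^ 2 - 2 * q * a - (a - 2 * q) ∧
    correction c (p ^ 3) = q ^ 2 * a - (q ^ 2 - 2 * q * a) ∧
    correction c (p ^ 4) = -(q ^ 2 * a) ∧ ∀ k, correction c (p ^ (k + 5)) = 0 := by
  have w0 : weightedTriples c (p ^ 0) = 1 := by
    rw [pow_zero, (isMultiplicative_weightedTriples hc).map_one]
  have w1 : weightedTriples c (p ^ (0 + 1)) = a := by rw [zero_add, pow_one, ha]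
  have w2 := weightedTriples_prime_pow (c := c) hp
  set m := ((μ : ArithmeticFunction ℤ) : ArithmeticFunction ℝ) with hm
  set f₁ := weightedTriples c * c.pmul m with hf₁
  set f₂ := f₁ * c.pmul m with hf₂
  have one (f g : ArithmeticFunction ℝ) (hf : f 1 = 1) (hg : g 1 = 1) : (f * g) (p ^ 0) = 1 := by
    rw [pow_zero, mul_apply_one, hf, hg, one_mul]
  have m1 : m 1 = 1 := by simp [hm]
  have cm1 : c.pmul m 1 = 1 := by rw [pmul_apply, hc.map_one, m1, one_mul]
  have s₁ (k : ℕ) := mul_pmul_moebius_prime_pow_succ hc (weightedTriples c) hp k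
  have s₂ (k : ℕ) := mul_pmul_moebius_prime_pow_succ hc f₁ hp k
  have s₃ (k : ℕ) := mul_moebius_prime_pow_succ f₂ hp k
  simp only [← hm, ← hf₁, ← hf₂, hq] at s₁ s₂ s₃
  -- In local series at `p`: `1 + aX` is multiplied by `1 - qX` twice and then by `1 - X`.
  have x0 : f₁ (p ^ 0) = 1 := one _ _ (by simpa using w0) cm1
  have x1 : f₁ (p ^ (0 + 1)) = a - q := by rw [s₁, w1, w0]; ring
  have x2 : f₁ (p ^ (1 + 1)) = -(q * a) := by rw [s₁, w2 0, w1]; ring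
  have x3 (k : ℕ) : f₁ (p ^ (k + 2 + 1)) = 0 := by rw [s₁, w2 (k + 1), w2]; ring
  have y0 : f₂ (p ^ 0) = 1 := one _ _ (by simpa using x0) cm1
  have y1 : f₂ (p ^ (0 + 1)) = a - 2 * q := by rw [s₂, x1, x0]; ring
  have y2 : f₂ (p ^ (1 + 1)) = q ^ 2 - 2 * q * a := by rw [s₂, x2, x1]; ring
  have y3 : f₂ (p ^ (2 + 1)) = q ^ 2 * a := by rw [s₂, x3 0, x2]; ring
  have y4 (k : ℕ) : f₂ (p ^ (k + 3 + 1)) = 0 := by rw [s₂, x3 (k + 1), x3]; ring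
  have hcor : correction c = f₂ * m := rfl
  rw [hcor]
  refine ⟨one _ _ (by simpa using y0) m1, ?_, ?_, ?_, ?_, fun k ↦ ?_⟩
  · exact (s₃ 0).trans (by rw [y1, y0])
  · exact (s₃ 1).trans (by rw [y2, y1])
  · exact (s₃ 2).trans (by rw [y3, y2])
  · exact (s₃ 3).trans (by rw [y4 0, y3]; ring)
  · exact (s₃ (k + 4)).trans (by rw [y4 (k + 1), y4]; ring)

/-- A nonnegative multiplicative function is summable when its Euler factors are
`≤ 1 + b p` for a summable `b`. -/
theorem summable_of_multiplicative {f : ℕ → ℝ} (hf : ∀ n, 0 ≤ f n) (h0 : f 0 = 0) (h1 : f 1 = 1)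
    (hmul : ∀ {m n}, Nat.Coprime m n → f (m * n) = f m * f n) {b : ℕ → ℝ} (hb : ∀ n, 0 ≤ b n)
    (hbs : Summable b) (hp : ∀ {p : ℕ}, p.Prime → Summable (fun k ↦ f (p ^ k)))
    (hle : ∀ {p : ℕ}, p.Prime → ∑' k, f (p ^ k) ≤ 1 + b p) : Summable f := by
  refine summable_of_sum_le (c := Real.exp (∑' n, b n)) hf fun s ↦ ?_
  -- Every positive element of `s` lies below `N`, hence is `N`-smooth, so the finite sum is bounded
  -- by a finite Euler product.
  set N := s.sup id + 1 with hN
  have hsum := (EulerProduct.summable_and_hasSum_smoothNumbers_prod_primesBelow_tsum h1 hmul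
    (fun hpp ↦ by simpa [Real.norm_eq_abs, abs_of_nonneg (hf _)] using hp hpp) N).2
  have hind := hasSum_subtype_iff_indicator.mp
    (show HasSum (f ∘ ((↑) : N.smoothNumbers → ℕ)) _ from hsum)
  have hs : ∑ n ∈ s, f n ≤ ∏ p ∈ N.primesBelow, ∑' k, f (p ^ k) := by
    calc ∑ n ∈ s, f n ≤ ∑ n ∈ s, (N.smoothNumbers).indicator f n := by
          refine sum_le_sum fun n hn ↦ ?_
          rcases Nat.eq_zero_or_pos n with rfl | hpos
          · rw [h0]
            exact Set.indicator_nonneg (fun x _ ↦ hf x) 0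
          · have hlt : n < N := Nat.lt_succ_of_le (Finset.le_sup (f := id) hn)
            rw [Set.indicator_of_mem (Nat.mem_smoothNumbers_of_lt hpos hlt)]
      _ ≤ _ := sum_le_hasSum s (fun n _ ↦ Set.indicator_nonneg (fun x _ ↦ hf x) n) hind
  refine hs.trans ?_
  calc ∏ p ∈ N.primesBelow, ∑' k, f (p ^ k) ≤ ∏ p ∈ N.primesBelow, Real.exp (b p) := by
        refine prod_le_prod (fun p _ ↦ tsum_nonneg fun k ↦ hf _) fun p hpp ↦ ?_
        have := hle (Nat.prime_of_mem_primesBelow hpp)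
        have := Real.add_one_le_exp (b p)
        linarith
    _ = Real.exp (∑ p ∈ N.primesBelow, b p) := (Real.exp_sum _ _).symm
    _ ≤ _ := Real.exp_le_exp.mpr (hbs.sum_le_tsum _ fun n _ ↦ hb n)

theorem hasSum_of_vanish_five {f : ℕ → ℝ} (h : ∀ k, f (k + 5) = 0) :
    HasSum f (f 0 + f 1 + f 2 + f 3 + f 4) := by
  have : HasSum f (∑ k ∈ range 5, f k) := hasSum_sum_of_ne_finset_zero (fun k hk ↦ by
    rw [mem_range, not_lt] at hk
    obtain ⟨j, rfl⟩ := Nat.exists_eq_add_of_le' hk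
    exact h j)
  simpa [sum_range_succ] using this

theorem abs_weightedTriples_prime_le (hc : IsBoundedCharacter c) {p : ℕ} (hp : p.Prime) :
    |weightedTriples c p| ≤ 3 := by
  rw [weightedTriples_prime hc hp, oddSquarefree_apply]
  have := abs_le.mp (hc.abs_le p)
  rw [abs_le]
  split_ifs <;> constructor <;> linarith

/-- For odd `p` the value of the correction at `p` is `(2q+1) - 2q - 1 = 0`, so Euler factors differ
from 1 only at order `p^(-3/2)`. An exponent below 1 leaves room for a logarithm later. -/
theorem summable_correction_rpow (hc : IsBoundedCharacter c) :
    Summable fun n : ℕ ↦ |correction c n| * (n : ℝ) ^ (-(3 / 4 : ℝ)) := by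
  have hpow (p k : ℕ) : (((p ^ k : ℕ) : ℝ)) ^ (-(3 / 4 : ℝ)) = ((p : ℝ) ^ (-(3 / 4 : ℝ))) ^ k := by
    push_cast
    rw [← Real.rpow_natCast, ← Real.rpow_natCast, ← Real.rpow_mul (by positivity),
      ← Real.rpow_mul (by positivity), mul_comm]
  have key {p : ℕ} (hp : p.Prime) :
      HasSum (fun k : ℕ ↦ |correction c (p ^ k)| * ((p ^ k : ℕ) : ℝ) ^ (-(3 / 4 : ℝ)))
        (|correction c (p ^ 0)| * ((p : ℝ) ^ (-(3 / 4 : ℝ))) ^ 0 +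
          |correction c (p ^ 1)| * ((p : ℝ) ^ (-(3 / 4 : ℝ))) ^ 1 +
          |correction c (p ^ 2)| * ((p : ℝ) ^ (-(3 / 4 : ℝ))) ^ 2 +
          |correction c (p ^ 3)| * ((p : ℝ) ^ (-(3 / 4 : ℝ))) ^ 3 +
          |correction c (p ^ 4)| * ((p : ℝ) ^ (-(3 / 4 : ℝ))) ^ 4) := by
    simp_rw [hpow]
    apply hasSum_of_vanish_five
    intro k
    rw [(correction_prime_pow hc hp rfl rfl).2.2.2.2.2 k]
    simp
  -- `42 = 6 + 3 · 12`: 6 from the linear term, 12 from each of the degrees 2, 3, 4.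
  refine summable_of_multiplicative (b := fun n ↦ 42 * (n : ℝ) ^ (-(3 / 2 : ℝ)))
    (fun n ↦ by positivity) (by simp) (by simp [(isMultiplicative_correction hc).map_one])
    (fun {m n} h ↦ ?_) (fun n ↦ by positivity) ?_ (fun hp ↦ (key hp).summable) (fun {p} hp ↦ ?_)
  · rw [(isMultiplicative_correction hc).map_mul_of_coprime h, abs_mul]
    push_cast
    rw [Real.mul_rpow (by positivity) (by positivity)]
    ring
  · exact (Real.summable_nat_rpow.mpr (by norm_num)).mul_left 42
  · rw [(key hp).tsum_eq]
    set x : ℝ := (p : ℝ) ^ (-(3 / 4 : ℝ)) with hx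
    have hx0 : 0 ≤ x := by positivity
    have hp1 : (1 : ℝ) ≤ p := by exact_mod_cast hp.one_lt.le
    have hx1 : x ≤ 1 := Real.rpow_le_one_of_one_le_of_nonpos hp1 (by norm_num)
    have hxx : (p : ℝ) ^ (-(3 / 2 : ℝ)) = x ^ 2 := by
      rw [hx, ← Real.rpow_natCast, ← Real.rpow_mul (by positivity)]
      norm_num
    simp only [hxx]
    obtain ⟨e0, e1, e2, e3, e4, -⟩ := correction_prime_pow hc hp rfl rfl
    set q := c p
    set a := weightedTriples c p with ha
    have hq : |q| ≤ 1 := hc.abs_le p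
    have ha3 : |a| ≤ 3 := abs_weightedTriples_prime_le hc hp
    have hq2 : |q ^ 2| ≤ 1 := by rw [abs_pow]; exact pow_le_one₀ (abs_nonneg _) hq
    have hqa : |q * a| ≤ 3 := by
      rw [abs_mul]
      calc |q| * |a| ≤ 1 * 3 := mul_le_mul hq ha3 (abs_nonneg _) zero_le_one
        _ = 3 := one_mul 3
    have hq2a : |q ^ 2 * a| ≤ 3 := by
      rw [abs_mul]
      calc |q ^ 2| * |a| ≤ 1 * 3 := mul_le_mul hq2 ha3 (abs_nonneg _) zero_le_one
        _ = 3 := one_mul 3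
    rw [abs_le] at hq ha3 hq2 hqa hq2a
    have b2 : |correction c (p ^ 2)| ≤ 12 := by
      rw [e2, abs_le]; constructor <;> linarith
    have b3 : |correction c (p ^ 3)| ≤ 12 := by
      rw [e3, abs_le]; constructor <;> linarith
    have b4 : |correction c (p ^ 4)| ≤ 12 := by
      rw [e4, abs_le]; constructor <;> linarith
    have b1 : |correction c (p ^ 1)| * x ≤ 6 * x ^ 2 := by
      -- At 2 the linear coefficient is `-2q - 1`, but `x ≥ 1/2` there, so `3x ≤ 6x²`.
      by_cases h2 : p = 2
      · have hbound : |correction c (p ^ 1)| ≤ 3 := by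
          have : a = 0 := by
            rw [ha, weightedTriples_prime hc hp, h2, oddSquarefree_two, zero_mul]
          rw [e1, abs_le]; constructor <;> linarith
        have hxlow : 1 / 2 ≤ x := by
          rw [hx, h2]
          calc (1 / 2 : ℝ) = (2 : ℝ) ^ (-1 : ℝ) := by rw [Real.rpow_neg_one]; norm_num
            _ ≤ _ := by
              push_cast
              exact Real.rpow_le_rpow_of_exponent_le (by norm_num) (by norm_num)
        nlinarith [mul_le_mul_of_nonneg_right hbound hx0]
      · have : a = 2 * q + 1 := by
          rw [ha, weightedTriples_prime hc hp, oddSquarefree_prime hp h2, one_mul]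
        rw [e1, this, show 2 * q + 1 - 2 * q - 1 = 0 by ring, abs_zero, zero_mul]
        positivity
    have hx3 : x ^ 3 ≤ x ^ 2 := pow_le_pow_of_le_one hx0 hx1 (by norm_num)
    have hx4 : x ^ 4 ≤ x ^ 2 := pow_le_pow_of_le_one hx0 hx1 (by norm_num)
    have c2 := mul_le_mul_of_nonneg_right b2 (pow_nonneg hx0 2)
    have c3 := mul_le_mul_of_nonneg_right b3 (pow_nonneg hx0 3)
    have c4 := mul_le_mul_of_nonneg_right b4 (pow_nonneg hx0 4)
    rw [e0, abs_one, pow_zero, pow_one x]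
    linarith

/-- The spare `n^(1/4)` absorbs the logarithm: `1 + log n ≤ (1 + 4) n^(1/4)`. -/
theorem summable_correction_log (hc : IsBoundedCharacter c) :
    Summable fun n : ℕ ↦ |correction c n| * (1 + Real.log n) / n := by
  refine Summable.of_nonneg_of_le (fun n ↦ ?_) (fun n ↦ ?_)
    ((summable_correction_rpow hc).mul_left 5)
  · have := Real.log_natCast_nonneg n
    positivity
  · rcases Nat.eq_zero_or_pos n with rfl | hn
    · simp
    have hn1 : (1 : ℝ) ≤ n := by exact_mod_cast hn
    have hn0 : (0 : ℝ) < n := by linarith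
    have h1 : Real.log n ≤ (n : ℝ) ^ (1 / 4 : ℝ) / (1 / 4) :=
      Real.log_le_rpow_div hn0.le (by norm_num)
    have h2 : (1 : ℝ) ≤ (n : ℝ) ^ (1 / 4 : ℝ) := Real.one_le_rpow hn1 (by norm_num)
    have h3 : (n : ℝ) ^ (1 / 4 : ℝ) / n = (n : ℝ) ^ (-(3 / 4 : ℝ)) := by
      rw [← Real.rpow_sub_one hn0.ne']
      norm_num
    calc |correction c n| * (1 + Real.log n) / n
        ≤ |correction c n| * (5 * (n : ℝ) ^ (1 / 4 : ℝ)) / n := by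
          gcongr
          linarith
      _ = 5 * (|correction c n| * (n : ℝ) ^ (-(3 / 4 : ℝ))) := by rw [← h3]; ring

theorem summable_correction_div (hc : IsBoundedCharacter c) :
    Summable fun n : ℕ ↦ |correction c n| / n := by
  refine Summable.of_nonneg_of_le (fun n ↦ by positivity) (fun n ↦ ?_) (summable_correction_log hc)
  have := Real.log_natCast_nonneg n
  gcongr
  nlinarith [abs_nonneg (correction c n)]

theorem isBoundedCharacter_zeta :
    IsBoundedCharacter ((ζ : ArithmeticFunction ℕ) : ArithmeticFunction ℝ) where
  map_one := by simp
  map_mul m n := by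
    simp only [natCoe_apply, zeta_apply, mul_eq_zero]
    by_cases hm : m = 0 <;> by_cases hn : n = 0 <;> simp [hm, hn]
  abs_le n := by
    simp only [natCoe_apply, zeta_apply]
    split_ifs <;> simp

/-- The Euler product is `5 / 2` times the mean value of the correction function. -/
theorem hasProd_biquadraticEulerFactor :
    HasProd biquadraticEulerFactor
      ((∑' n : ℕ, correction ((ζ : ArithmeticFunction ℕ) : ArithmeticFunction ℝ) n / n) *
        (5 / 2)) := by
  have hz := isBoundedCharacter_zeta
  set z := ((ζ : ArithmeticFunction ℕ) : ArithmeticFunction ℝ) with hzdef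
  have hmul := isMultiplicative_correction hz
  have h1 : HasProd (fun p : Nat.Primes ↦ ∑' e : ℕ, correction z ((p : ℕ) ^ e) /
      (((p : ℕ) ^ e : ℕ) : ℝ)) (∑' n : ℕ, correction z n / n) := by
    refine EulerProduct.eulerProduct_hasProd (f := fun n : ℕ ↦ correction z n / n)
      (by simp [hmul.map_one]) (fun {m n} h ↦ ?_) ?_ (by simp)
    · simp only [hmul.map_mul_of_coprime h]
      push_cast
      rw [mul_div_mul_comm]
    · refine (summable_correction_div hz).congr fun n ↦ ?_
      rw [Real.norm_eq_abs, abs_div, Nat.abs_cast]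
  -- At 2 the weighted count vanishes, so the correction's factor is only `(1 - 1/2)³`; the missing
  -- `1 + 3/2` is supplied separately.
  have h2 : HasProd (fun p : Nat.Primes ↦ if (p : ℕ) = 2 then (5 / 2 : ℝ) else 1) (5 / 2) := by
    have := hasProd_single (f := fun p : Nat.Primes ↦ if (p : ℕ) = 2 then (5 / 2 : ℝ) else 1)
      ⟨2, Nat.prime_two⟩ (fun p hp ↦ if_neg fun h ↦ hp (Subtype.ext h))
    simpa using this
  refine (h1.mul h2).congr_fun fun p ↦ ?_
  have hp := p.2
  have hp0 : ((p : ℕ) : ℝ) ≠ 0 := by exact_mod_cast hp.ne_zero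
  have hzp : z p = 1 := by simp [hzdef, hp.ne_zero]
  obtain ⟨e0, e1, e2, e3, e4, e5⟩ := correction_prime_pow hz hp hzp rfl
  have hs := hasSum_of_vanish_five
    (f := fun e : ℕ ↦ correction z ((p : ℕ) ^ e) / (((p : ℕ) ^ e : ℕ) : ℝ))
    (fun k ↦ by simp only [e5, zero_div])
  rw [hs.tsum_eq]
  simp only [e0, e1, e2, e3, e4]
  rw [weightedTriples_prime hz hp, hzp, biquadraticEulerFactor]
  push_cast
  by_cases h : (p : ℕ) = 2
  · rw [if_pos h, h, oddSquarefree_two]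
    norm_num
  · rw [if_neg h, oddSquarefree_prime hp h]
    field_simp
    ring

end DirichletConvolution

/-! ### Summatory functions: the main term and the twisted sum. -/

section Summatory

open ArithmeticFunction Finset
open scoped ArithmeticFunction.zeta ArithmeticFunction.Moebius

/-- The sum of `f n` over `1 ≤ n ≤ y`. -/
noncomputable def summatory (f : ArithmeticFunction ℝ) (y : ℝ) : ℝ := ∑ n ∈ Ioc 0 ⌊y⌋₊, f n

theorem summatory_mul (f g : ArithmeticFunction ℝ) (y : ℝ) :
    summatory (f * g) y = ∑ m ∈ Ioc 0 ⌊y⌋₊, f m * summatory g (y / m) := by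
  rw [summatory, sum_Ioc_mul_eq_sum_sum]
  refine sum_congr rfl fun m _ ↦ ?_
  rw [summatory, Nat.floor_div_natCast]

theorem one_le_div_of_mem_Ioc_floor {y : ℝ} {m : ℕ} (hm : m ∈ Ioc 0 ⌊y⌋₊) :
    (1 : ℝ) ≤ m ∧ (m : ℝ) ≤ y ∧ 1 ≤ y / m := by
  rw [mem_Ioc] at hm
  have h1 : (1 : ℝ) ≤ m := by exact_mod_cast hm.1
  have h2 : (m : ℝ) ≤ y := (Nat.le_floor_iff' hm.1.ne').mp hm.2
  exact ⟨h1, h2, (one_le_div₀ (by linarith)).mpr h2⟩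

theorem summatory_zeta (y : ℝ) :
    summatory ((ζ : ArithmeticFunction ℕ) : ArithmeticFunction ℝ) y = ⌊y⌋₊ := by
  rw [summatory]
  simp_rw [natCoe_apply]
  exact_mod_cast sum_Ioc_zeta ⌊y⌋₊

theorem sum_inv_floor_bounds {y : ℝ} (hy : 1 ≤ y) :
    Real.log y ≤ ∑ m ∈ Ioc 0 ⌊y⌋₊, (m : ℝ)⁻¹ ∧
      ∑ m ∈ Ioc 0 ⌊y⌋₊, (m : ℝ)⁻¹ ≤ 1 + Real.log y := by
  have e : ∑ m ∈ Ioc 0 ⌊y⌋₊, (m : ℝ)⁻¹ = ((harmonic ⌊y⌋₊ : ℚ) : ℝ) := by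
    rw [harmonic_eq_sum_Icc]
    push_cast
    rfl
  rw [e]
  exact ⟨log_le_harmonic_floor y (by linarith), harmonic_floor_le_one_add_log y hy⟩

/-- Dropping the fractional parts in `∑ ⌊y/m⌋` costs `O(y)`, which suffices since only leading terms
matter. -/
theorem summatory_zeta_mul_zeta {y : ℝ} (hy : 1 ≤ y) :
    |summatory (((ζ : ArithmeticFunction ℕ) : ArithmeticFunction ℝ) *
      ((ζ : ArithmeticFunction ℕ) : ArithmeticFunction ℝ)) y - y * Real.log y| ≤ y := by
  obtain ⟨h1, h2⟩ := sum_inv_floor_bounds hy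
  have hfl : (⌊y⌋₊ : ℝ) ≤ y := Nat.floor_le (by linarith)
  have e : summatory (((ζ : ArithmeticFunction ℕ) : ArithmeticFunction ℝ) *
      ((ζ : ArithmeticFunction ℕ) : ArithmeticFunction ℝ)) y
      = ∑ m ∈ Ioc 0 ⌊y⌋₊, (⌊y / m⌋₊ : ℝ) := by
    rw [summatory_mul]
    refine sum_congr rfl fun m hm ↦ ?_
    rw [mem_Ioc] at hm
    rw [summatory_zeta, natCoe_apply, zeta_apply, if_neg hm.1.ne', Nat.cast_one, one_mul]
  have up : ∑ m ∈ Ioc 0 ⌊y⌋₊, (⌊y / m⌋₊ : ℝ) ≤ y * ∑ m ∈ Ioc 0 ⌊y⌋₊, (m : ℝ)⁻¹ := by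
    rw [mul_sum]
    refine sum_le_sum fun m hm ↦ ?_
    rw [← div_eq_mul_inv]
    exact Nat.floor_le (by positivity)
  have low : y * ∑ m ∈ Ioc 0 ⌊y⌋₊, (m : ℝ)⁻¹ - ⌊y⌋₊ ≤ ∑ m ∈ Ioc 0 ⌊y⌋₊, (⌊y / m⌋₊ : ℝ) := by
    rw [mul_sum]
    have : (⌊y⌋₊ : ℝ) = ∑ m ∈ Ioc 0 ⌊y⌋₊, (1 : ℝ) := by simp
    rw [this, ← sum_sub_distrib]
    refine sum_le_sum fun m hm ↦ ?_
    rw [← div_eq_mul_inv]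
    exact (Nat.sub_one_lt_floor (y / m)).le
  rw [e, abs_le]
  constructor <;> nlinarith

/-- A discrete form of `∫₁^y log(y/t)/t dt = (log y)²/2`. With `L a = log(y/a)`, each summand is
close to `L(a)²/2 - L(a+1)²/2`, with an error at most `(1 + log y)(1/a - 1/(a+1))`; both bounds
telescope. -/
theorem sum_log_div_bound {y : ℝ} (hy : 1 ≤ y) :
    |∑ m ∈ Ioc 0 ⌊y⌋₊, Real.log (y / m) / m - Real.log y ^ 2 / 2| ≤ 2 * (1 + Real.log y) := by
  set N := ⌊y⌋₊ with hN
  have hy0 : 0 < y := by linarith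
  have hlog : 0 ≤ Real.log y := Real.log_nonneg hy
  set L : ℕ → ℝ := fun a ↦ Real.log (y / a) with hL
  have hstep (a : ℕ) (ha : a ∈ Ioc 0 N) :
      |L a / a - (L a ^ 2 / 2 - L (a + 1) ^ 2 / 2)| ≤
        (1 + Real.log y) * ((a : ℝ)⁻¹ - ((a + 1 : ℕ) : ℝ)⁻¹) := by
    obtain ⟨ha1, hay, hya⟩ := one_le_div_of_mem_Ioc_floor ha
    have ha0 : (0 : ℝ) < a := by linarith
    set δ := Real.log (1 + (a : ℝ)⁻¹) with hδ
    have hLs : L (a + 1) = L a - δ := by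
      simp only [hL, hδ]
      rw [Real.log_div hy0.ne' (by positivity), Real.log_div hy0.ne' ha0.ne',
        show 1 + (a : ℝ)⁻¹ = ((a + 1 : ℕ) : ℝ) / a by push_cast; field_simp,
        Real.log_div (by positivity) ha0.ne']
      ring
    have hδ1 : δ ≤ (a : ℝ)⁻¹ := by
      have := Real.log_le_sub_one_of_pos (x := 1 + (a : ℝ)⁻¹) (by positivity)
      linarith
    have hδ2 : ((a + 1 : ℕ) : ℝ)⁻¹ ≤ δ := by
      have := Real.one_sub_inv_le_log_of_pos (x := 1 + (a : ℝ)⁻¹) (by positivity)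
      have e : 1 - (1 + (a : ℝ)⁻¹)⁻¹ = ((a + 1 : ℕ) : ℝ)⁻¹ := by
        push_cast
        field_simp
        ring
      linarith
    have hδ0 : 0 ≤ δ := le_trans (by positivity) hδ2
    have hLa0 : 0 ≤ L a := Real.log_nonneg hya
    have hLa1 : L a ≤ Real.log y := by
      apply Real.log_le_log (by positivity)
      exact div_le_self hy0.le ha1
    have hsq : δ ^ 2 / 2 ≤ (a : ℝ)⁻¹ - ((a + 1 : ℕ) : ℝ)⁻¹ := by
      have h1 : δ ^ 2 ≤ ((a : ℝ)⁻¹) ^ 2 := pow_le_pow_left₀ hδ0 hδ1 2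
      have h2 : ((a : ℝ)⁻¹) ^ 2 / 2 ≤ (a : ℝ)⁻¹ - ((a + 1 : ℕ) : ℝ)⁻¹ := by
        push_cast
        rw [← sub_nonneg]
        have : (a : ℝ)⁻¹ - ((a : ℝ) + 1)⁻¹ - (a : ℝ)⁻¹ ^ 2 / 2
            = (a - 1) / (2 * a ^ 2 * (a + 1)) := by
          field_simp
          ring
        rw [this]
        apply div_nonneg (by linarith) (by positivity)
      linarith
    have e : L a / a - (L a ^ 2 / 2 - L (a + 1) ^ 2 / 2) = L a * ((a : ℝ)⁻¹ - δ) + δ ^ 2 / 2 := by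
      rw [hLs, div_eq_mul_inv]
      ring
    rw [e, abs_of_nonneg (by
      have := mul_nonneg hLa0 (sub_nonneg.mpr hδ1)
      positivity)]
    have h3 : L a * ((a : ℝ)⁻¹ - δ) ≤ Real.log y * ((a : ℝ)⁻¹ - ((a + 1 : ℕ) : ℝ)⁻¹) :=
      mul_le_mul hLa1 (by linarith) (by linarith) hlog
    linarith
  have tele (f : ℕ → ℝ) : ∑ a ∈ Ioc 0 N, (f a - f (a + 1)) = f 1 - f (N + 1) := by
    rw [show Ioc 0 N = Ico 1 (N + 1) by ext; simp; omega, ← neg_inj, ← sum_neg_distrib]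
    simp only [neg_sub]
    exact sum_Ico_sub f (by omega)
  have hsum : |∑ a ∈ Ioc 0 N, L a / a - (L 1 ^ 2 / 2 - L (N + 1) ^ 2 / 2)| ≤ 1 + Real.log y := by
    rw [← tele (fun a ↦ L a ^ 2 / 2), ← sum_sub_distrib]
    refine (abs_sum_le_sum_abs _ _).trans ((sum_le_sum hstep).trans ?_)
    rw [← mul_sum, tele (fun a ↦ ((a : ℕ) : ℝ)⁻¹)]
    have : (0 : ℝ) ≤ ((N + 1 : ℕ) : ℝ)⁻¹ := by positivity
    push_cast at this ⊢
    nlinarith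
  have hL1 : L 1 = Real.log y := by simp [hL]
  -- As `y < N + 1 ≤ 2y`, the quotient `y/(N+1)` is between `1/2` and 1.
  have hend : L (N + 1) ^ 2 ≤ 1 := by
    have hN1 : (1 : ℝ) ≤ N := by exact_mod_cast Nat.floor_pos.mpr hy
    have hNy : (N : ℝ) ≤ y := Nat.floor_le hy0.le
    have hyN : y < N + 1 := Nat.lt_floor_add_one y
    have h1 : L (N + 1) ≤ 0 := by
      apply Real.log_nonpos (by positivity)
      push_cast
      rw [div_le_one (by positivity)]
      exact hyN.le
    have h2 : -1 ≤ L (N + 1) := by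
      have := Real.one_sub_inv_le_log_of_pos (x := y / ((N + 1 : ℕ) : ℝ)) (by positivity)
      have h3 : (y / ((N + 1 : ℕ) : ℝ))⁻¹ ≤ 2 := by
        rw [inv_div, div_le_iff₀ hy0]
        push_cast
        linarith
      simp only [hL]
      linarith
    nlinarith
  rw [hL1] at hsum
  rw [abs_le] at hsum ⊢
  have := sq_nonneg (L (N + 1))
  constructor <;> linarith [hsum.1, hsum.2]

theorem summatory_zeta_cubed {y : ℝ} (hy : 1 ≤ y) :
    |summatory (((ζ : ArithmeticFunction ℕ) : ArithmeticFunction ℝ) *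
      ((ζ : ArithmeticFunction ℕ) : ArithmeticFunction ℝ) *
      ((ζ : ArithmeticFunction ℕ) : ArithmeticFunction ℝ)) y - y * Real.log y ^ 2 / 2| ≤
      3 * y * (1 + Real.log y) := by
  set z := ((ζ : ArithmeticFunction ℕ) : ArithmeticFunction ℝ) with hz
  have hy0 : 0 < y := by linarith
  rw [mul_assoc, summatory_mul]
  have h1 : |∑ m ∈ Ioc 0 ⌊y⌋₊, z m * summatory (z * z) (y / m) -
      y * ∑ m ∈ Ioc 0 ⌊y⌋₊, Real.log (y / m) / m| ≤ y * (1 + Real.log y) := by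
    rw [mul_sum, ← sum_sub_distrib]
    refine (abs_sum_le_sum_abs _ _).trans ?_
    refine le_trans ?_ (mul_le_mul_of_nonneg_left (sum_inv_floor_bounds hy).2 hy0.le)
    rw [mul_sum]
    refine sum_le_sum fun m hm ↦ ?_
    obtain ⟨h1, h2, h3⟩ := one_le_div_of_mem_Ioc_floor hm
    have hzm : z m = 1 := by
      rw [mem_Ioc] at hm
      rw [hz, natCoe_apply, zeta_apply, if_neg hm.1.ne', Nat.cast_one]
    have := summatory_zeta_mul_zeta h3
    rw [hzm, one_mul, ← div_eq_mul_inv,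
      show y * (Real.log (y / m) / m) = y / m * Real.log (y / m) by ring]
    exact this
  have h2 := mul_le_mul_of_nonneg_left (sum_log_div_bound hy) hy0.le
  rw [← abs_of_pos hy0, ← abs_mul, abs_of_pos hy0] at h2
  rw [abs_le] at h1 h2 ⊢
  constructor <;> linarith [h1.1, h1.2, h2.1, h2.2]

/-- The main term of the count of all ordered triples. -/
theorem exists_summatory_weightedTriples_zeta :
    ∃ A : ℝ, ∀ y : ℝ, 1 ≤ y →
      |summatory (weightedTriples ((ζ : ArithmeticFunction ℕ) : ArithmeticFunction ℝ)) y -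
        (∑' n : ℕ, correction ((ζ : ArithmeticFunction ℕ) : ArithmeticFunction ℝ) n / n) *
          (y * Real.log y ^ 2 / 2)| ≤ A * (y * (1 + Real.log y)) := by
  have hc := isBoundedCharacter_zeta
  set z := ((ζ : ArithmeticFunction ℕ) : ArithmeticFunction ℝ) with hz
  set g := correction z with hg
  set B := ∑' n : ℕ, |g n| * (1 + Real.log n) / n with hB
  have hsB := summable_correction_log hc
  have hs1 : Summable fun n : ℕ ↦ g n / n := by
    refine Summable.of_norm ((summable_correction_div hc).congr fun n ↦ ?_)
    rw [Real.norm_eq_abs, abs_div, Nat.abs_cast]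
  -- `3B` comes from the error in `summatory_zeta_cubed`, and `B` from replacing `log(y/m)` by `log
  -- y` and completing the series.
  refine ⟨4 * B, fun y hy ↦ ?_⟩
  have hy0 : 0 < y := by linarith
  have hlog : 0 ≤ Real.log y := Real.log_nonneg hy
  rw [← correction_mul hc, summatory_mul]
  have hnn (n : ℕ) : 0 ≤ |g n| * (1 + Real.log n) / n := by
    have := Real.log_natCast_nonneg n
    positivity
  -- Extending by 0 beyond `y` lets the truncated sum and the full series be compared termwise. For
  -- `n > y` the discrepancy `(log y)²` is at most `log n · log y`.
  set φ : ℕ → ℝ := fun m ↦ if m ∈ Ioc 0 ⌊y⌋₊ then Real.log (y / m) ^ 2 else 0 with hφ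
  have hφb (n : ℕ) (hn : n ≠ 0) : |φ n - Real.log y ^ 2| ≤ 2 * (Real.log n * Real.log y) := by
    have hn1 : (1 : ℝ) ≤ n := by exact_mod_cast Nat.one_le_iff_ne_zero.mpr hn
    have hln : 0 ≤ Real.log n := Real.log_nonneg hn1
    simp only [hφ]
    split_ifs with hm
    · obtain ⟨h1, h2, h3⟩ := one_le_div_of_mem_Ioc_floor hm
      have hle : Real.log n ≤ Real.log y := Real.log_le_log (by linarith) h2
      rw [Real.log_div hy0.ne' (by linarith), abs_le]
      constructor <;> nlinarith
    · have hlt : y < n := by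
        by_contra hcon
        exact hm (mem_Ioc.mpr ⟨Nat.pos_of_ne_zero hn, Nat.le_floor (not_lt.mp hcon)⟩)
      have hle : Real.log y ≤ Real.log n := Real.log_le_log hy0 hlt.le
      rw [zero_sub, abs_neg, abs_of_nonneg (by positivity)]
      nlinarith
  have hterm (n : ℕ) : |g n / n * (φ n - Real.log y ^ 2)| ≤
      2 * Real.log y * (|g n| * (1 + Real.log n) / n) := by
    rcases eq_or_ne n 0 with rfl | hn
    · simp
    have hln := Real.log_natCast_nonneg n
    rw [abs_mul, abs_div, Nat.abs_cast]
    calc |g n| / n * |φ n - Real.log y ^ 2|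
        ≤ |g n| / n * (2 * ((1 + Real.log n) * Real.log y)) := by
          gcongr
          refine (hφb n hn).trans ?_
          gcongr
          linarith
      _ = _ := by ring
  have hmain : |∑ m ∈ Ioc 0 ⌊y⌋₊, g m / m * Real.log (y / m) ^ 2 -
      (∑' n : ℕ, g n / n) * Real.log y ^ 2| ≤ 2 * Real.log y * B := by
    have e1 : HasSum (fun n : ℕ ↦ g n / n * φ n)
        (∑ m ∈ Ioc 0 ⌊y⌋₊, g m / m * Real.log (y / m) ^ 2) := by
      have : ∑ m ∈ Ioc 0 ⌊y⌋₊, g m / m * Real.log (y / m) ^ 2 =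
          ∑ m ∈ Ioc 0 ⌊y⌋₊, g m / m * φ m :=
        sum_congr rfl fun m hm ↦ by simp only [hφ]; rw [if_pos hm]
      rw [this]
      exact hasSum_sum_of_ne_finset_zero fun n hn ↦ by simp only [hφ]; rw [if_neg hn, mul_zero]
    have e2 := e1.sub (hs1.hasSum.mul_right (Real.log y ^ 2))
    have e3 : HasSum (fun n : ℕ ↦ g n / n * (φ n - Real.log y ^ 2))
        (∑ m ∈ Ioc 0 ⌊y⌋₊, g m / m * Real.log (y / m) ^ 2 -
          (∑' n : ℕ, g n / n) * Real.log y ^ 2) := by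
      simp only [mul_sub]
      exact e2
    have := tsum_of_norm_bounded (hsB.hasSum.mul_left (2 * Real.log y)) (fun n ↦ by
      rw [Real.norm_eq_abs]; exact hterm n)
    rwa [e3.tsum_eq, Real.norm_eq_abs] at this
  have herr : |∑ m ∈ Ioc 0 ⌊y⌋₊, g m * summatory (z * z * z) (y / m) -
      y / 2 * ∑ m ∈ Ioc 0 ⌊y⌋₊, g m / m * Real.log (y / m) ^ 2| ≤
      3 * y * (1 + Real.log y) * B := by
    rw [mul_sum, ← sum_sub_distrib]
    refine (abs_sum_le_sum_abs _ _).trans ?_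
    refine le_trans ?_ (mul_le_mul_of_nonneg_left (hsB.sum_le_tsum (Ioc 0 ⌊y⌋₊)
      fun n _ ↦ hnn n) (by positivity))
    rw [mul_sum]
    refine sum_le_sum fun m hm ↦ ?_
    obtain ⟨h1, h2, h3⟩ := one_le_div_of_mem_Ioc_floor hm
    have hm0 : (0 : ℝ) < m := by linarith
    have hlm := Real.log_natCast_nonneg m
    have hb := summatory_zeta_cubed h3
    have hle : Real.log (y / m) ≤ Real.log y :=
      Real.log_le_log (by positivity) (div_le_self hy0.le h1)
    calc |g m * summatory (z * z * z) (y / m) - y / 2 * (g m / m * Real.log (y / m) ^ 2)|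
        = |g m| * |summatory (z * z * z) (y / m) - y / m * Real.log (y / m) ^ 2 / 2| := by
          rw [← abs_mul]
          congr 1
          field_simp
      _ ≤ |g m| * (3 * (y / m) * (1 + Real.log (y / m))) := by gcongr
      _ ≤ |g m| * (3 * (y / m) * (1 + Real.log y)) := by gcongr
      _ = 3 * y * (1 + Real.log y) * (|g m| * 1 / m) := by ring
      _ ≤ 3 * y * (1 + Real.log y) * (|g m| * (1 + Real.log m) / m) := by
          gcongr
          linarith
  have hB0 : 0 ≤ B := tsum_nonneg hnn
  have h5 : |y / 2 * ∑ m ∈ Ioc 0 ⌊y⌋₊, g m / m * Real.log (y / m) ^ 2 -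
      (∑' n : ℕ, g n / n) * (y * Real.log y ^ 2 / 2)| ≤ y * Real.log y * B := by
    have := mul_le_mul_of_nonneg_left hmain (by positivity : 0 ≤ y / 2)
    rw [← abs_of_pos (by positivity : 0 < y / 2), ← abs_mul,
      abs_of_pos (by positivity : 0 < y / 2)] at this
    calc _ = |y / 2 * (∑ m ∈ Ioc 0 ⌊y⌋₊, g m / m * Real.log (y / m) ^ 2 -
          (∑' n : ℕ, g n / n) * Real.log y ^ 2)| := by congr 1; ring
      _ ≤ _ := this
      _ = _ := by ring
  have h6 : 0 ≤ y * B := by positivity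
  rw [abs_le] at herr h5 ⊢
  constructor <;> linarith [herr.1, herr.2, h5.1, h5.2]

/-- The quadratic character modulo `4`. -/
noncomputable def chiFour : ArithmeticFunction ℝ := ⟨fun n ↦ ((ZMod.χ₄ n : ℤ) : ℝ), by simp⟩

theorem chiFour_apply (n : ℕ) : chiFour n = ((ZMod.χ₄ n : ℤ) : ℝ) := rfl

theorem chiFour_eq (n : ℕ) :
    chiFour n = if n % 2 = 0 then 0 else if n % 4 = 1 then 1 else -1 := by
  rw [chiFour_apply, ZMod.χ₄_nat_eq_if_mod_four]
  split_ifs <;> simp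

theorem isBoundedCharacter_chiFour : IsBoundedCharacter chiFour where
  map_one := by rw [chiFour_eq]; norm_num
  map_mul m n := by simp only [chiFour_apply]; push_cast; rw [map_mul]; push_cast; rfl
  abs_le n := by rw [chiFour_eq]; split_ifs <;> simp

theorem sum_chiFour (N : ℕ) :
    ∑ n ∈ Ioc 0 N, chiFour n = if N % 4 = 1 ∨ N % 4 = 2 then 1 else 0 := by
  induction N with
  | zero => simp
  | succ N ih =>
    rw [sum_Ioc_succ_top (Nat.zero_le N), ih, chiFour_eq]
    have : N % 4 = 0 ∨ N % 4 = 1 ∨ N % 4 = 2 ∨ N % 4 = 3 := by omega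
    rcases this with h | h | h | h
    · rw [if_neg (by omega), if_neg (by omega), if_pos (by omega), if_pos (by omega)]; norm_num
    · rw [if_pos (by omega), if_pos (by omega), if_pos (by omega)]; norm_num
    · rw [if_pos (by omega), if_neg (by omega), if_neg (by omega), if_neg (by omega)]; norm_num
    · rw [if_neg (by omega), if_pos (by omega), if_neg (by omega)]; norm_num

theorem abs_summatory_chiFour_le (y : ℝ) : |summatory chiFour y| ≤ 1 := by
  rw [summatory, sum_chiFour]
  split_ifs <;> simp

/-- One factor `χ` is summed first, with partial sums bounded by 1; the rest, `χ * ζ`, is dominated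
by the divisor function. The twist thus saves a logarithm. -/
theorem abs_summatory_chiFour_mul_le {y : ℝ} (hy : 1 ≤ y) :
    |summatory (chiFour * chiFour * ((ζ : ArithmeticFunction ℕ) : ArithmeticFunction ℝ)) y| ≤
      y * (1 + Real.log y) := by
  set z := ((ζ : ArithmeticFunction ℕ) : ArithmeticFunction ℝ) with hz
  rw [show chiFour * chiFour * z = (chiFour * z) * chiFour by ring, summatory_mul]
  have hd (m : ℕ) : |(chiFour * z) m| ≤ (z * z) m := by
    rw [mul_apply, mul_apply]
    refine (abs_sum_le_sum_abs _ _).trans (sum_le_sum fun x hx ↦ ?_)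
    have h0 : x.1 ≠ 0 := Nat.left_ne_zero_of_mem_divisorsAntidiagonal hx
    have hz0 : 0 ≤ z x.2 := by rw [hz, natCoe_apply]; positivity
    have hz1 : z x.1 = 1 := by rw [hz, natCoe_apply, zeta_apply, if_neg h0, Nat.cast_one]
    rw [abs_mul, abs_of_nonneg hz0, hz1]
    exact mul_le_mul_of_nonneg_right (isBoundedCharacter_chiFour.abs_le _) hz0
  calc |∑ m ∈ Ioc 0 ⌊y⌋₊, (chiFour * z) m * summatory chiFour (y / m)|
      ≤ ∑ m ∈ Ioc 0 ⌊y⌋₊, (z * z) m := by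
        refine (abs_sum_le_sum_abs _ _).trans (sum_le_sum fun m _ ↦ ?_)
        rw [abs_mul]
        exact (mul_le_of_le_one_right (abs_nonneg _) (abs_summatory_chiFour_le _)).trans (hd m)
    _ ≤ y * (1 + Real.log y) := by
        have := (abs_le.mp (summatory_zeta_mul_zeta hy)).2
        rw [summatory] at this
        linarith

/-- The character sum over ordered triples is negligible. -/
theorem exists_summatory_weightedTriples_chiFour :
    ∃ A : ℝ, ∀ y : ℝ, 1 ≤ y →
      |summatory (weightedTriples chiFour) y| ≤ A * (y * (1 + Real.log y)) := by
  have hc := isBoundedCharacter_chiFour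
  refine ⟨∑' n : ℕ, |correction chiFour n| / n, fun y hy ↦ ?_⟩
  have hy0 : 0 < y := by linarith
  have hlog : 0 ≤ Real.log y := Real.log_nonneg hy
  rw [← correction_mul hc, summatory_mul]
  refine (abs_sum_le_sum_abs _ _).trans ?_
  refine le_trans ?_ (mul_le_mul_of_nonneg_right ((summable_correction_div hc).sum_le_tsum
    (Ioc 0 ⌊y⌋₊) fun n _ ↦ by positivity) (by positivity))
  rw [sum_mul]
  refine sum_le_sum fun m hm ↦ ?_
  obtain ⟨h1, h2, h3⟩ := one_le_div_of_mem_Ioc_floor hm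
  have hle : Real.log (y / m) ≤ Real.log y :=
    Real.log_le_log (by positivity) (div_le_self hy0.le h1)
  rw [abs_mul]
  calc _ ≤ |correction chiFour m| * (y / m * (1 + Real.log (y / m))) := by
        gcongr
        exact abs_summatory_chiFour_mul_le h3
    _ ≤ |correction chiFour m| * (y / m * (1 + Real.log y)) := by gcongr
    _ = _ := by ring

end Summatory

/-! ### From fields to ordered triples and summatory functions. -/

section Counting

open ArithmeticFunction Finset
open scoped ArithmeticFunction.zeta

theorem sum_Ioc_sum_divisorsAntidiagonal {M : Type*} [AddCommMonoid M] (F : ℕ → ℕ → M) (N : ℕ) :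
    ∑ n ∈ Ioc 0 N, ∑ x ∈ n.divisorsAntidiagonal, F x.1 x.2 =
      ∑ a ∈ Ioc 0 N, ∑ b ∈ Ioc 0 N, if a * b ≤ N then F a b else 0 := by
  trans ∑ n ∈ Ioc 0 N, ∑ x ∈ Ioc 0 N ×ˢ Ioc 0 N with x.1 * x.2 = n, F x.1 x.2
  · refine sum_congr rfl fun n hn ↦ ?_
    rw [mem_Ioc] at hn
    rw [Nat.divisorsAntidiagonal_eq_prod_filter_of_le hn.1.ne' hn.2]
  · simp_rw [sum_filter]
    rw [sum_comm, sum_product]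
    refine sum_congr rfl fun a ha ↦ sum_congr rfl fun b hb ↦ ?_
    rw [mem_Ioc] at ha hb
    have : 0 < a * b := Nat.mul_pos ha.1 hb.1
    simp [this]

/-- The ordered triples `(u, v, w)` with `uvw ≤ N` odd and squarefree. -/
def orderedTriples (N : ℕ) : Finset (ℕ × ℕ × ℕ) :=
  (Ioc 0 N ×ˢ Ioc 0 N ×ˢ Ioc 0 N).filter fun p ↦
    p.1 * p.2.1 * p.2.2 ≤ N ∧ Odd (p.1 * p.2.1 * p.2.2) ∧ Squarefree (p.1 * p.2.1 * p.2.2)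

theorem mem_orderedTriples {N u v w : ℕ} : (u, v, w) ∈ orderedTriples N ↔
    u * v * w ≤ N ∧ Odd (u * v * w) ∧ Squarefree (u * v * w) := by
  simp only [orderedTriples, mem_filter, mem_product, mem_Ioc, and_iff_right_iff_imp]
  rintro ⟨h1, -, h2⟩
  have h0 := h2.ne_zero
  have hw : 0 < w := Nat.pos_of_ne_zero (right_ne_zero_of_mul h0)
  have hv : 0 < v := Nat.pos_of_ne_zero (right_ne_zero_of_mul (left_ne_zero_of_mul h0))
  have hu : 0 < u := Nat.pos_of_ne_zero (left_ne_zero_of_mul (left_ne_zero_of_mul h0))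
  refine ⟨⟨hu, le_trans ?_ h1⟩, ⟨hv, le_trans ?_ h1⟩, hw, le_trans ?_ h1⟩
  · exact Nat.le_of_dvd (Nat.pos_of_ne_zero h0) ⟨v * w, by ring⟩
  · exact Nat.le_of_dvd (Nat.pos_of_ne_zero h0) ⟨u * w, by ring⟩
  · exact Nat.le_of_dvd (Nat.pos_of_ne_zero h0) ⟨u * v, by ring⟩

theorem sum_orderedTriples (c : ArithmeticFunction ℝ) (N : ℕ) :
    ∑ p ∈ orderedTriples N, c p.1 * c p.2.1 = ∑ n ∈ Ioc 0 N, weightedTriples c n := by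
  have h1 : ∑ n ∈ Ioc 0 N, weightedTriples c n = ∑ n ∈ Ioc 0 N, ∑ x ∈ n.divisorsAntidiagonal,
      oddSquarefree (x.1 * x.2) * (c * c) x.1 := by
    refine sum_congr rfl fun n _ ↦ ?_
    rw [weightedTriples, pmul_apply, mul_apply, mul_sum]
    refine sum_congr rfl fun x hx ↦ ?_
    have h0 : x.2 ≠ 0 := Nat.right_ne_zero_of_mem_divisorsAntidiagonal hx
    rw [(Nat.mem_divisorsAntidiagonal.mp hx).1, natCoe_apply, zeta_apply, if_neg h0, Nat.cast_one,
      mul_one]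
  have h2 (w : ℕ) : ∑ a ∈ Ioc 0 N, (if a * w ≤ N then oddSquarefree (a * w) * (c * c) a else 0) =
      ∑ a ∈ Ioc 0 N, ∑ y ∈ a.divisorsAntidiagonal,
        if y.1 * y.2 * w ≤ N then oddSquarefree (y.1 * y.2 * w) * (c y.1 * c y.2) else 0 := by
    refine sum_congr rfl fun a _ ↦ ?_
    have : ∑ y ∈ a.divisorsAntidiagonal,
        (if y.1 * y.2 * w ≤ N then oddSquarefree (y.1 * y.2 * w) * (c y.1 * c y.2) else 0) =
        ∑ y ∈ a.divisorsAntidiagonal,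
        (if a * w ≤ N then oddSquarefree (a * w) * (c y.1 * c y.2) else 0) :=
      sum_congr rfl fun y hy ↦ by rw [(Nat.mem_divisorsAntidiagonal.mp hy).1]
    rw [this, mul_apply, mul_sum]
    split_ifs <;> simp
  rw [h1, sum_Ioc_sum_divisorsAntidiagonal (fun a b ↦ oddSquarefree (a * b) * (c * c) a),
    sum_comm]
  simp_rw [h2]
  have h3 (w : ℕ) := sum_Ioc_sum_divisorsAntidiagonal (M := ℝ) (fun u v ↦
    if u * v * w ≤ N then oddSquarefree (u * v * w) * (c u * c v) else 0) N
  simp only [h3]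
  rw [sum_comm, orderedTriples, sum_filter, sum_product]
  refine sum_congr rfl fun u hu ↦ ?_
  rw [sum_product, sum_comm]
  refine sum_congr rfl fun w hw ↦ sum_congr rfl fun v hv ↦ ?_
  rw [mem_Ioc] at hu hv hw
  simp only [oddSquarefree_apply]
  by_cases h : u * v * w ≤ N
  · have h' : u * v ≤ N := le_trans (Nat.le_mul_of_pos_right _ hw.1) h
    by_cases hh : Odd (u * v * w) ∧ Squarefree (u * v * w)
    · rw [if_pos ⟨h, hh⟩, if_pos h', if_pos h, if_pos hh, one_mul]
    · rw [if_neg (fun k ↦ hh k.2), if_pos h', if_pos h, if_neg hh, zero_mul]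
  · rw [if_neg (fun k ↦ h k.1), if_neg h]
    simp

theorem sum_swap_left {M : Type*} [AddCommMonoid M] {Q : Finset (ℕ × ℕ × ℕ)}
    (hQ : ∀ {u v w}, (u, v, w) ∈ Q → (v, u, w) ∈ Q) (F : ℕ → ℕ → ℕ → M) :
    ∑ p ∈ Q, F p.2.1 p.1 p.2.2 = ∑ p ∈ Q, F p.1 p.2.1 p.2.2 :=
  sum_nbij' (fun p ↦ (p.2.1, p.1, p.2.2)) (fun p ↦ (p.2.1, p.1, p.2.2)) (fun _ h ↦ hQ h)
    (fun _ h ↦ hQ h) (fun _ _ ↦ rfl) (fun _ _ ↦ rfl) (fun _ _ ↦ rfl)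

theorem sum_swap_right {M : Type*} [AddCommMonoid M] {Q : Finset (ℕ × ℕ × ℕ)}
    (hQ : ∀ {u v w}, (u, v, w) ∈ Q → (u, w, v) ∈ Q) (F : ℕ → ℕ → ℕ → M) :
    ∑ p ∈ Q, F p.1 p.2.2 p.2.1 = ∑ p ∈ Q, F p.1 p.2.1 p.2.2 :=
  sum_nbij' (fun p ↦ (p.1, p.2.2, p.2.1)) (fun p ↦ (p.1, p.2.2, p.2.1)) (fun _ h ↦ hQ h)
    (fun _ h ↦ hQ h) (fun _ _ ↦ rfl) (fun _ _ ↦ rfl) (fun _ _ ↦ rfl)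

/-- In a symmetric set of triples, each sorted triple accounts for six triples with distinct
entries. -/
theorem six_mul_card_sorted {Q : Finset (ℕ × ℕ × ℕ)}
    (h12 : ∀ {u v w}, (u, v, w) ∈ Q → (v, u, w) ∈ Q)
    (h23 : ∀ {u v w}, (u, v, w) ∈ Q → (u, w, v) ∈ Q) :
    6 * #{p ∈ Q | p.1 < p.2.1 ∧ p.2.1 < p.2.2} =
      #{p ∈ Q | p.1 ≠ p.2.1 ∧ p.1 ≠ p.2.2 ∧ p.2.1 ≠ p.2.2} := by
  set s : ℕ → ℕ → ℕ → ℕ := fun u v w ↦ if u < v ∧ v < w then 1 else 0 with hs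
  -- Distinct entries are increasing in exactly one of six orders; symmetry of `Q` makes the six
  -- sums equal.
  have hpt (u v w : ℕ) : (if u ≠ v ∧ u ≠ w ∧ v ≠ w then 1 else 0) =
      s u v w + s v u w + s u w v + s v w u + s w u v + s w v u := by
    simp only [hs]
    split_ifs <;> omega
  have e2 := sum_swap_left h12 s
  have e3 := sum_swap_right h23 s
  have e4 := (sum_swap_left h12 (fun u v w ↦ s u w v)).trans e3
  have e5 := (sum_swap_right h23 (fun u v w ↦ s v u w)).trans e2
  have e6 := (sum_swap_right h23 (fun u v w ↦ s v w u)).trans e4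
  rw [card_filter, card_filter]
  simp only [hpt, sum_add_distrib]
  change 6 * ∑ p ∈ Q, s p.1 p.2.1 p.2.2 = _
  omega

/-- The congruence condition modulo `4` under which the discriminant is odd. -/
def AgreeModFour (p : ℕ × ℕ × ℕ) : Prop := p.1 % 4 = p.2.1 % 4 ∧ p.2.1 % 4 = p.2.2 % 4

instance : DecidablePred AgreeModFour := fun p ↦ by unfold AgreeModFour; infer_instance

/-- For signs `χ(u), χ(v), χ(w)`, one plus the three pairwise products is 4 if they all agree and 0
otherwise. By symmetry the three products have equal sums. -/
theorem four_mul_card_agree (N : ℕ) :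
    4 * (#{p ∈ orderedTriples N | AgreeModFour p} : ℝ) =
      ∑ n ∈ Ioc 0 N, weightedTriples ((ζ : ArithmeticFunction ℕ) : ArithmeticFunction ℝ) n +
        3 * ∑ n ∈ Ioc 0 N, weightedTriples chiFour n := by
  have h12 {u v w : ℕ} (h : (u, v, w) ∈ orderedTriples N) : (v, u, w) ∈ orderedTriples N := by
    rw [mem_orderedTriples] at h ⊢
    rwa [mul_comm v u]
  have h23 {u v w : ℕ} (h : (u, v, w) ∈ orderedTriples N) : (u, w, v) ∈ orderedTriples N := by
    rw [mem_orderedTriples] at h ⊢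
    rwa [mul_right_comm]
  have hone : ∑ p ∈ orderedTriples N, (1 : ℝ) =
      ∑ n ∈ Ioc 0 N, weightedTriples ((ζ : ArithmeticFunction ℕ) : ArithmeticFunction ℝ) n := by
    rw [← sum_orderedTriples]
    refine sum_congr rfl fun p hp ↦ ?_
    have h0 := (mem_orderedTriples.mp hp).2.2.ne_zero
    have h1 := left_ne_zero_of_mul h0
    simp [left_ne_zero_of_mul h1, right_ne_zero_of_mul h1]
  have e1 := sum_orderedTriples chiFour N
  have e2 := (sum_swap_right h23 (fun u v _ ↦ chiFour u * chiFour v)).trans e1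
  have e3 := (sum_swap_left h12 (fun u _ w ↦ chiFour u * chiFour w)).trans e2
  have hpt : ∀ p ∈ orderedTriples N, 4 * (if AgreeModFour p then (1 : ℝ) else 0) =
      1 + chiFour p.1 * chiFour p.2.1 + chiFour p.1 * chiFour p.2.2 +
        chiFour p.2.1 * chiFour p.2.2 := by
    rintro ⟨u, v, w⟩ hp
    have hodd := (mem_orderedTriples.mp hp).2.1
    have hou := Nat.odd_iff.mp (Nat.Odd.of_mul_left (Nat.Odd.of_mul_left hodd))
    have hov := Nat.odd_iff.mp (Nat.Odd.of_mul_right (Nat.Odd.of_mul_left hodd))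
    have how := Nat.odd_iff.mp (Nat.Odd.of_mul_right hodd)
    have key (n : ℕ) (hn : n % 2 = 1) : n % 4 = 1 ∧ chiFour n = 1 ∨ n % 4 = 3 ∧ chiFour n = -1 := by
      rw [chiFour_eq, if_neg (by omega)]
      split_ifs with h
      · exact Or.inl ⟨h, rfl⟩
      · exact Or.inr ⟨by omega, rfl⟩
    have hA : AgreeModFour (u, v, w) ↔ u % 4 = v % 4 ∧ v % 4 = w % 4 := Iff.rfl
    rcases key u hou with ⟨a, a'⟩ | ⟨a, a'⟩ <;> rcases key v hov with ⟨b, b'⟩ | ⟨b, b'⟩ <;>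
      rcases key w how with ⟨d, d'⟩ | ⟨d, d'⟩ <;>
      simp only [hA, a, b, d, a', b', d'] <;> norm_num
  rw [card_filter]
  push_cast
  rw [mul_sum, sum_congr rfl hpt, sum_add_distrib, sum_add_distrib, sum_add_distrib, hone, e1, e2,
    e3]
  ring

theorem card_orderedTriples (N : ℕ) : (#(orderedTriples N) : ℝ) =
    ∑ n ∈ Ioc 0 N, weightedTriples ((ζ : ArithmeticFunction ℕ) : ArithmeticFunction ℝ) n := by
  rw [← sum_orderedTriples, card_eq_sum_ones]
  push_cast
  refine sum_congr rfl fun p hp ↦ ?_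
  have h0 := (mem_orderedTriples.mp hp).2.2.ne_zero
  have h1 := left_ne_zero_of_mul h0
  simp [left_ne_zero_of_mul h1, right_ne_zero_of_mul h1]

/-- The ordered triples whose field has discriminant at most `X`. -/
noncomputable def boundedTriples (X : ℝ) : Finset (ℕ × ℕ × ℕ) :=
  {p ∈ orderedTriples ⌊√X⌋₊ | AgreeModFour p} ∪ {p ∈ orderedTriples ⌊√X / 4⌋₊ | ¬AgreeModFour p}

/-- Under the square root the discriminant factor 16 becomes the cutoff `√X / 4`. -/
theorem mem_boundedTriples {X : ℝ} {u v w : ℕ} : (u, v, w) ∈ boundedTriples X ↔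
    Odd (u * v * w) ∧ Squarefree (u * v * w) ∧
      ((discrFactor u v w * (u * v * w) ^ 2 : ℕ) : ℝ) ≤ X := by
  simp only [boundedTriples, mem_union, mem_filter, mem_orderedTriples]
  by_cases hsq : Squarefree (u * v * w)
  swap
  · tauto
  have h0 : u * v * w ≠ 0 := hsq.ne_zero
  have hpos : (0 : ℝ) < (u * v * w : ℕ) := by exact_mod_cast Nat.pos_of_ne_zero h0
  by_cases h : AgreeModFour (u, v, w)
  · have hf : discrFactor u v w = 1 := if_pos h
    rw [hf, Nat.le_floor_iff' h0, Real.le_sqrt' hpos]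
    push_cast
    rw [one_mul]
    tauto
  · have hf : discrFactor u v w = 16 := if_neg h
    have e : ((u * v * w : ℕ) : ℝ) ≤ √X / 4 ↔ ((16 * (u * v * w) ^ 2 : ℕ) : ℝ) ≤ X := by
      rw [le_div_iff₀ (by norm_num), Real.le_sqrt' (by positivity)]
      push_cast
      ring_nf
    rw [hf, ← e, ← Nat.le_floor_iff' h0]
    tauto

theorem boundedTriples_swap_left {X : ℝ} {u v w : ℕ} (h : (u, v, w) ∈ boundedTriples X) :
    (v, u, w) ∈ boundedTriples X := by
  rw [mem_boundedTriples] at h ⊢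
  have : discrFactor v u w = discrFactor u v w := by
    unfold discrFactor
    congr 1
    rw [eq_iff_iff]
    omega
  rwa [mul_comm v u, this]

theorem boundedTriples_swap_right {X : ℝ} {u v w : ℕ} (h : (u, v, w) ∈ boundedTriples X) :
    (u, w, v) ∈ boundedTriples X := by
  rw [mem_boundedTriples] at h ⊢
  have : discrFactor u w v = discrFactor u v w := by
    unfold discrFactor
    congr 1
    rw [eq_iff_iff]
    omega
  rwa [mul_right_comm, this]

theorem sortedTriples_eq_coe (X : ℝ) : {p ∈ sortedTriples |
    ((discrFactor p.1 p.2.1 p.2.2 * (p.1 * p.2.1 * p.2.2) ^ 2 : ℕ) : ℝ) ≤ X} =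
      ↑({p ∈ boundedTriples X | p.1 < p.2.1 ∧ p.2.1 < p.2.2} : Finset (ℕ × ℕ × ℕ)) := by
  ext ⟨u, v, w⟩
  rw [mem_coe, mem_filter, mem_boundedTriples]
  simp only [sortedTriples, Set.mem_ofPred_eq]
  tauto

theorem finite_oddRealBiquadraticFieldsUpTo (X : ℝ) : (oddRealBiquadraticFieldsUpTo X).Finite := by
  rw [oddRealBiquadraticFieldsUpTo_eq_image, sortedTriples_eq_coe]
  exact (finite_toSet _).image _

theorem ncard_oddRealBiquadraticFieldsUpTo (X : ℝ) : (oddRealBiquadraticFieldsUpTo X).ncard =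
    #{p ∈ boundedTriples X | p.1 < p.2.1 ∧ p.2.1 < p.2.2} := by
  rw [oddRealBiquadraticFieldsUpTo_eq_image, Set.InjOn.ncard_image
    (biquadraticField_injOn.mono (Set.sep_subset _ _)), sortedTriples_eq_coe,
    Set.ncard_coe_finset]

/-- A repeated entry has its square dividing a squarefree product, so it is 1, and only the third
entry is free. -/
theorem card_not_distinct_le (X : ℝ) :
    #{p ∈ boundedTriples X | ¬(p.1 ≠ p.2.1 ∧ p.1 ≠ p.2.2 ∧ p.2.1 ≠ p.2.2)} ≤ 3 * ⌊√X⌋₊ := by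
  have hsub : {p ∈ boundedTriples X | ¬(p.1 ≠ p.2.1 ∧ p.1 ≠ p.2.2 ∧ p.2.1 ≠ p.2.2)} ⊆
      (Ioc 0 ⌊√X⌋₊).image (fun n ↦ (1, 1, n)) ∪ (Ioc 0 ⌊√X⌋₊).image (fun n ↦ (1, n, 1)) ∪
        (Ioc 0 ⌊√X⌋₊).image (fun n ↦ (n, 1, 1)) := by
    rintro ⟨u, v, w⟩ hp
    rw [mem_filter] at hp
    obtain ⟨hp, hne⟩ := hp
    have hsq := (mem_boundedTriples.mp hp).2.1
    have hord : (u, v, w) ∈ orderedTriples ⌊√X⌋₊ := by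
      rw [boundedTriples, mem_union, mem_filter, mem_filter] at hp
      rcases hp with hp | hp
      · exact hp.1
      · have h1 := mem_orderedTriples.mp hp.1
        refine mem_orderedTriples.mpr ⟨h1.1.trans (Nat.floor_mono ?_), h1.2⟩
        have := Real.sqrt_nonneg X
        linarith
    rw [orderedTriples, mem_filter, mem_product, mem_product] at hord
    obtain ⟨⟨hu, hv, hw⟩, -⟩ := hord
    have one {n m : ℕ} (hd : u * v * w = n * n * m) : n = 1 :=
      Nat.isUnit_iff.mp (hsq n ⟨m, hd⟩)
    simp only [mem_union, mem_image, Prod.mk.injEq]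
    have : u = v ∨ u = w ∨ v = w := by
      simp only at hne
      tauto
    rcases this with rfl | rfl | rfl
    · have h1 := one (n := u) (m := w) rfl
      exact Or.inl (Or.inl ⟨w, hw, h1.symm, h1.symm, rfl⟩)
    · have h1 := one (n := u) (m := v) (by ring)
      exact Or.inl (Or.inr ⟨v, hv, h1.symm, rfl, h1.symm⟩)
    · have h1 := one (n := v) (m := u) (by ring)
      exact Or.inr ⟨u, hu, rfl, h1.symm, h1.symm⟩
  refine (card_le_card hsub).trans ?_
  have c1 := card_image_le (s := Ioc 0 ⌊√X⌋₊) (f := fun n ↦ ((1 : ℕ), (1 : ℕ), n))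
  have c2 := card_image_le (s := Ioc 0 ⌊√X⌋₊) (f := fun n ↦ ((1 : ℕ), n, (1 : ℕ)))
  have c3 := card_image_le (s := Ioc 0 ⌊√X⌋₊) (f := fun n ↦ (n, (1 : ℕ), (1 : ℕ)))
  rw [Nat.card_Ioc] at c1 c2 c3
  refine (card_union_le _ _).trans ?_
  have := card_union_le ((Ioc 0 ⌊√X⌋₊).image (fun n ↦ ((1 : ℕ), (1 : ℕ), n)))
    ((Ioc 0 ⌊√X⌋₊).image (fun n ↦ ((1 : ℕ), n, (1 : ℕ))))
  omega

/-- The number of fields in terms of the two summatory functions. -/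
theorem abs_six_mul_ncard_sub_le (X : ℝ) :
    |6 * ((oddRealBiquadraticFieldsUpTo X).ncard : ℝ) -
      ((summatory (weightedTriples ((ζ : ArithmeticFunction ℕ) : ArithmeticFunction ℝ)) √X +
          3 * summatory (weightedTriples chiFour) √X) / 4 +
        (3 * summatory (weightedTriples ((ζ : ArithmeticFunction ℕ) : ArithmeticFunction ℝ))
          (√X / 4) - 3 * summatory (weightedTriples chiFour) (√X / 4)) / 4)| ≤ 3 * √X := by
  have h6 := six_mul_card_sorted (boundedTriples_swap_left (X := X)) boundedTriples_swap_right
  have hsplit := card_filter_add_card_filter_not (s := boundedTriples X)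
    (fun p ↦ p.1 ≠ p.2.1 ∧ p.1 ≠ p.2.2 ∧ p.2.1 ≠ p.2.2)
  have hbad := card_not_distinct_le X
  have hcard : #(boundedTriples X) = #{p ∈ orderedTriples ⌊√X⌋₊ | AgreeModFour p} +
      #{p ∈ orderedTriples ⌊√X / 4⌋₊ | ¬AgreeModFour p} := by
    rw [boundedTriples]
    apply card_union_of_disjoint
    rw [disjoint_left]
    intro p hp hq
    exact (mem_filter.mp hq).2 (mem_filter.mp hp).2
  have hneg := card_filter_add_card_filter_not (s := orderedTriples ⌊√X / 4⌋₊) AgreeModFour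
  have a1 := four_mul_card_agree ⌊√X⌋₊
  -- Disagreeing triples are all triples minus agreeing ones, whence the weights `3` and `-3` at `√X
  -- / 4`.
  have a2 := four_mul_card_agree ⌊√X / 4⌋₊
  have a3 := card_orderedTriples ⌊√X / 4⌋₊
  rw [ncard_oddRealBiquadraticFieldsUpTo]
  unfold summatory
  have hfl : (⌊√X⌋₊ : ℝ) ≤ √X := Nat.floor_le (Real.sqrt_nonneg X)
  have h6' := congrArg (Nat.cast (R := ℝ)) h6
  have hsplit' := congrArg (Nat.cast (R := ℝ)) hsplit
  have hcard' := congrArg (Nat.cast (R := ℝ)) hcard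
  have hneg' := congrArg (Nat.cast (R := ℝ)) hneg
  have hbad' := (Nat.cast_le (α := ℝ)).mpr hbad
  have hnn := Nat.cast_nonneg (α := ℝ)
    #{p ∈ boundedTriples X | ¬(p.1 ≠ p.2.1 ∧ p.1 ≠ p.2.2 ∧ p.2.1 ≠ p.2.2)}
  push_cast at h6' hsplit' hcard' hneg' hbad'
  rw [abs_le]
  constructor <;> linarith

end Counting

/-! ### Assembling the asymptotic formula. -/

theorem mainTheorem10 :
    (∀ X : ℝ, (oddRealBiquadraticFieldsUpTo X).Finite) ∧
    Multipliable biquadraticEulerFactor ∧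
    (fun X : ℝ => ((oddRealBiquadraticFieldsUpTo X).ncard : ℝ) -
        7 / 1920 * Real.sqrt X * (Real.log X) ^ 2 * ∏' p : Nat.Primes, biquadraticEulerFactor p)
      =O[atTop] (fun X : ℝ => Real.sqrt X * Real.log X) := by
  refine ⟨finite_oddRealBiquadraticFieldsUpTo, hasProd_biquadraticEulerFactor.multipliable, ?_⟩
  rw [hasProd_biquadraticEulerFactor.tprod_eq]
  obtain ⟨A₁, hA₁⟩ := exists_summatory_weightedTriples_zeta
  obtain ⟨A₂, hA₂⟩ := exists_summatory_weightedTriples_chiFour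
  set C := ∑' n : ℕ, correction
    ((ArithmeticFunction.zeta : ArithmeticFunction ℕ) : ArithmeticFunction ℝ) n / n
  -- Already a bound for six times the error against `Y l`: `3` from repeated entries, `2(1/4 +
  -- 3/4)|A₁|`, `2(3/4 + 3/4)|A₂|`, and `|C|` from `log(Y/4) = l - log 4`.
  refine IsBigO.of_bound (3 + 2 * |A₁| + 3 * |A₂| + |C|) ?_
  -- From 16 on, `Y / 4 ≥ 1`, so both estimates apply there, and `l ≥ log 4 ≥ 1`.
  filter_upwards [eventually_ge_atTop (16 : ℝ)] with X hX
  have h6 := abs_six_mul_ncard_sub_le X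
  set Y := √X with hY
  set l := Real.log Y with hl
  set k := Real.log 4 with hk
  have hY4 : 4 ≤ Y := Real.le_sqrt_of_sq_le (by linarith)
  have hY0 : 0 < Y := by linarith
  have hk1 : 1 ≤ k := by
    rw [hk, Real.le_log_iff_exp_le (by norm_num)]
    linarith [Real.exp_one_lt_d9]
  have hk2 : k ≤ 2 := by
    rw [hk, Real.log_le_iff_le_exp (by norm_num)]
    have := Real.exp_one_gt_d9
    have e : Real.exp 2 = Real.exp 1 * Real.exp 1 := by rw [← Real.exp_add]; norm_num
    rw [e]
    nlinarith
  have hkl : k ≤ l := Real.log_le_log (by norm_num) hY4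
  have hlogX : Real.log X = 2 * l := by
    rw [hl, hY, Real.log_sqrt (by linarith)]
    ring
  have hlog4 : Real.log (Y / 4) = l - k := Real.log_div hY0.ne' (by norm_num)
  have hYl : 0 ≤ Y * l := mul_nonneg hY0.le (by linarith)
  have hE : Y * (1 + l) ≤ 2 * (Y * l) := by nlinarith
  have hE0 : 0 ≤ Y * (1 + l) := mul_nonneg hY0.le (by linarith)
  have hE' : Y / 4 * (1 + (l - k)) ≤ 2 * (Y * l) := by nlinarith
  have hE0' : 0 ≤ Y / 4 * (1 + (l - k)) := mul_nonneg (by linarith) (by linarith)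
  have bound {A E : ℝ} (h0 : 0 ≤ E) (hE : E ≤ 2 * (Y * l)) : A * E ≤ 2 * |A| * (Y * l) :=
    calc A * E ≤ |A| * E := mul_le_mul_of_nonneg_right (le_abs_self A) h0
      _ ≤ |A| * (2 * (Y * l)) := mul_le_mul_of_nonneg_left hE (abs_nonneg A)
      _ = _ := by ring
  have n1 := (hA₁ Y (by linarith)).trans (bound hE0 hE)
  have n2 := hA₁ (Y / 4) (by linarith)
  have c1 := (hA₂ Y (by linarith)).trans (bound hE0 hE)
  have c2 := hA₂ (Y / 4) (by linarith)
  rw [hlog4] at n2 c2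
  replace n2 := n2.trans (bound hE0' hE')
  replace c2 := c2.trans (bound hE0' hE')
  -- The lower-order part of `(l - k)²` in the second main term, with `3/32 = (3/4)(1/4)(1/2)`.
  have hmain : |C * (3 / 32 * (Y * (k ^ 2 - 2 * k * l)))| ≤ |C| * (Y * l) := by
    rw [abs_mul]
    refine mul_le_mul_of_nonneg_left ?_ (abs_nonneg C)
    have hkk : 0 ≤ Y * (k * (2 * l - k)) :=
      mul_nonneg hY0.le (mul_nonneg (by linarith) (by linarith))
    have hkl2 : Y * (k * (2 * l - k)) ≤ Y * (4 * l) :=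
      mul_le_mul_of_nonneg_left (by nlinarith) hY0.le
    rw [abs_le]
    constructor <;> nlinarith
  have h3Y : 3 * Y ≤ 3 * (Y * l) := by nlinarith
  rw [Real.norm_eq_abs, Real.norm_eq_abs, hlogX, abs_of_nonneg (by linarith : 0 ≤ Y * (2 * l))]
  set S := ((oddRealBiquadraticFieldsUpTo X).ncard : ℝ)
  have hC0 : 0 ≤ |C| * (Y * l) := by positivity
  have hA10 : 0 ≤ |A₁| * (Y * l) := by positivity
  have hA20 : 0 ≤ |A₂| * (Y * l) := by positivity
  rw [abs_le] at *
  constructor <;>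
    linarith [h6.1, h6.2, n1.1, n1.2, n2.1, n2.2, c1.1, c1.2, c2.1, c2.2, hmain.1, hmain.2]
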